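/- **Theorem (Asymptotic normality of $\hat\theta_{disc}$).** Let $(Y_i,Z_i,X_i)_{i\ge 1}$ be i.i.d. with $$Y_i=\alpha_0+Z_i'\beta_0+X_i'\gamma_0+\epsilon_i,$$ where $Y_i,\epsilon_i\in\mathbb R$, $Z_i\in\mathbb R^{d_z}$, $X_i\in\mathbb R^{d_x}$; put $\theta_0:=(\alpha_0,\beta_0',\gamma_0')'\in\mathbb R^{d}$ with $d:=1+d_z+d_x$. Assume $\mathbb E[\epsilon_i\mid Z_i]=0$ almost surely and that $\mathbb E|\epsilon_i|^4$, $\mathbb E\|X_i\|^4$, $\mathbb E\|Z_i\|^4$ are finite. Let $(\mathcal Z_k)_{k=1}^K$ be a fixed finite partition of the support of $Z_i$ into measurable cells such that 1. $p_k:=\mathbb P(Z_i\in\mathcal Z_k)>0$ for all $k$; 2. (no partitional multicollinearity) with $\overline W_k:=\left(1,\ \mathbb E[Z_i\mid Z_i\in\mathcal Z_k]',\ \mathbb E[X_i\mid Z_i\in\mathcal Z_k]'\right)'$, the $K\times d$ matrix with rows $\overline W_1',\dots,\overline W_K'$ has rank $d$. From the first $n$ observations form $\tilde W_i:=(1,Z_i',X_i')'$,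 $D_{ik}:=\mathbf 1\{Z_i\in\mathcal Z_k\}$, the matrices $\tilde W$ and $D$ with rows $\tilde W_i'$ and $(D_{i1},\dots,D_{iK})$, the vector $Y=(Y_1,\dots,Y_n)'$, $P_D:=D(D'D)^{-1}D'$, and the two-stage least squares estimator with the cell dummies as instruments, $$\hat\theta_{disc}:=\left(\tilde W'P_D\tilde W\right)^{-1}\tilde W'P_DY .$$ Then $\hat\theta_{disc}$ is well defined (both inverses exist) with probability tending to one, $\sum_{k}p_k\overline W_k\overline W_k'$ is invertible, and $$\sqrt n\left(\hat\theta_{disc}-\theta_0\right)\overset{d}{\longrightarrow}\mathcal N(\mathbf 0,V_{0,disc}),$$ $$V_{0,disc}:=\Big(\sum_{k=1}^Kp_k\overline W_k\overline W_k'\Big)^{-1}\Big(\sum_{k=1}^Kp_k\overline\sigma_{\epsilon,k}^2\overline W_k\overline W_k'\Big)\Big(\sum_{k=1}^Kp_k\overline W_k\overline W_k'\Big)^{-1},\qquad \overline\sigma_{\epsilon,k}^2:=\mathbb E[\epsilon_i^2\mid Z_i\in\mathcal Z_k],$$ where $V_{0,disc}$ is positive semidefinite. Furthermore, let $n_k:=\sum_{i=1}^nD_{ik}$,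 $\hat p_k:=n_k/n$, $\hat{\overline W}_k:=\left(1,\ \frac1{n_k}\sum_{i=1}^nD_{ik}Z_i',\ \frac1{n_k}\sum_{i=1}^nD_{ik}X_i'\right)'$ and $\hat{\overline\sigma}_{\epsilon,k}^2:=\frac1{n_k}\sum_{i:\,Z_i\in\mathcal Z_k}(Y_i-\tilde W_i'\hat\theta_{disc})^2$, and let $\hat V_{disc}$ be obtained by replacing $p_k,\overline W_k,\overline\sigma^2_{\epsilon,k}$ in the formula for $V_{0,disc}$ by $\hat p_k,\hat{\overline W}_k,\hat{\overline\sigma}^2_{\epsilon,k}$. Then $\hat V_{disc}\to V_{0,disc}$ in probability. Finally, under homoskedasticity, i.e. if $\mathbb E[\epsilon_i^2\mid Z_i\in\mathcal Z_k]=\sigma_\epsilon^2$ for all $k$, the variance simplifies to $V_{0,disc}=\sigma_\epsilon^2\left(\sum_{k=1}^Kp_k\overline W_k\overline W_k'\right)^{-1}$, and $\hat\sigma_\epsilon^2:=\frac1n\sum_{i=1}^n(Y_i-\tilde W_i'\hat\theta_{disc})^2\to\sigma_\epsilon^2$ in probability. -/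

import Mathlib

open MeasureTheory ProbabilityTheory Filter Topology

noncomputable section

namespace DiscIV

/-- Euclidean space of dimension `d`. -/
abbrev Vec (d : ℕ) : Type := EuclideanSpace ℝ (Fin d)

/-- Index set of the `1 + dz + dx` coordinates of `(1, z', x')'` and of `(α, β', γ')'`. -/
abbrev Idx (dz dx : ℕ) : Type := Unit ⊕ (Fin dz ⊕ Fin dx)

/-- The stacked vector `(a, b', c')'`. -/
def stack {dz dx : ℕ} (a : ℝ) (b : Vec dz) (c : Vec dx) : Idx dz dx → ℝ :=
  Sum.elim (fun _ => a) (Sum.elim (fun j => b j) (fun j => c j))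

section Population

variable {Ω : Type*} [MeasurableSpace Ω] {dz dx K : ℕ}

/-- Cell probability `p_k = P(Z ∈ cell k)`. -/
def cellProb (P : Measure Ω) (cell : Fin K → Set (Vec dz)) (Z : Ω → Vec dz) (k : Fin K) : ℝ :=
  P.real (Z ⁻¹' cell k)

/-- Cell mean `E[U | Z ∈ cell k]`: the integral of `U` against the elementary conditional
probability given the event `{Z ∈ cell k}`. -/
def cellMean {F : Type*} [NormedAddCommGroup F] [NormedSpace ℝ F] (P : Measure Ω)
    (cell : Fin K → Set (Vec dz)) (Z : Ω → Vec dz) (U : Ω → F) (k : Fin K) : F :=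
  ∫ ω, U ω ∂(ProbabilityTheory.cond P (Z ⁻¹' cell k))

/-- `W̄_k = (1, E[Z | Z ∈ cell k]', E[X | Z ∈ cell k]')'`. -/
def wBar (P : Measure Ω) (cell : Fin K → Set (Vec dz)) (Z : Ω → Vec dz) (X : Ω → Vec dx)
    (k : Fin K) : Idx dz dx → ℝ :=
  stack 1 (cellMean P cell Z Z k) (cellMean P cell Z X k)

/-- The `K × (1 + dz + dx)` matrix whose rows are `W̄_k'`. -/
def wBarMatrix (P : Measure Ω) (cell : Fin K → Set (Vec dz)) (Z : Ω → Vec dz) (X : Ω → Vec dx) :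
    Matrix (Fin K) (Idx dz dx) ℝ :=
  Matrix.of (wBar P cell Z X)

end Population

section Formula

variable {dz dx K : ℕ}

/-- `∑ k, p_k W_k W_k'`. -/
def gram (p : Fin K → ℝ) (W : Fin K → Idx dz dx → ℝ) : Matrix (Idx dz dx) (Idx dz dx) ℝ :=
  ∑ k, p k • Matrix.vecMulVec (W k) (W k)

/-- `(∑ k, p_k W_k W_k')⁻¹ (∑ k, p_k s_k W_k W_k') (∑ k, p_k W_k W_k')⁻¹`. -/
def sandwich (p s : Fin K → ℝ) (W : Fin K → Idx dz dx → ℝ) :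
    Matrix (Idx dz dx) (Idx dz dx) ℝ :=
  (gram p W)⁻¹ * gram (fun k => p k * s k) W * (gram p W)⁻¹

end Formula

section Sample

variable {n dz dx K : ℕ}

/-- The `n × K` matrix of cell dummies `D_{ik} = 1{Z_i ∈ cell k}`. -/
def dummies (cell : Fin K → Set (Vec dz)) (z : Fin n → Vec dz) : Matrix (Fin n) (Fin K) ℝ :=
  Matrix.of fun i k => (cell k).indicator (fun _ => (1 : ℝ)) (z i)

/-- The `n × (1 + dz + dx)` matrix with rows `(1, Z_i', X_i')`. -/
def regressors (z : Fin n → Vec dz) (x : Fin n → Vec dx) : Matrix (Fin n) (Idx dz dx) ℝ :=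
  Matrix.of fun i => stack 1 (z i) (x i)

/-- `P_D = D (D'D)⁻¹ D'`. -/
def projD (D : Matrix (Fin n) (Fin K) ℝ) : Matrix (Fin n) (Fin n) ℝ :=
  D * (D.transpose * D)⁻¹ * D.transpose

/-- The two-stage least squares estimator `(W' P_D W)⁻¹ W' P_D Y`
with regressors `W` and the cell dummies `D` as instruments. -/
def tsls (cell : Fin K → Set (Vec dz)) (y : Fin n → ℝ) (z : Fin n → Vec dz)
    (x : Fin n → Vec dx) : EuclideanSpace ℝ (Idx dz dx) :=
  let W := regressors z x
  let PD := projD (dummies cell z)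
  WithLp.toLp 2 (((W.transpose * PD * W)⁻¹ * W.transpose * PD).mulVec y)

/-- The two matrices inverted in `tsls` are invertible. -/
def TslsWellDefined (cell : Fin K → Set (Vec dz)) (z : Fin n → Vec dz) (x : Fin n → Vec dx) :
    Prop :=
  IsUnit ((dummies cell z).transpose * dummies cell z) ∧
    IsUnit ((regressors z x).transpose * projD (dummies cell z) * regressors z x)

/-- `n_k`, the number of observations in cell `k`. -/
def cellCount (cell : Fin K → Set (Vec dz)) (z : Fin n → Vec dz) (k : Fin K) : ℝ :=
  ∑ i, dummies cell z i k

/-- `p̂_k = n_k / n`. -/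
def pHat (cell : Fin K → Set (Vec dz)) (z : Fin n → Vec dz) (k : Fin K) : ℝ :=
  cellCount cell z k / n

/-- Sample cell average `(1 / n_k) ∑_i D_{ik} u_i`. -/
def cellAvg {F : Type*} [AddCommGroup F] [Module ℝ F] (cell : Fin K → Set (Vec dz))
    (z : Fin n → Vec dz) (u : Fin n → F) (k : Fin K) : F :=
  (cellCount cell z k)⁻¹ • ∑ i, dummies cell z i k • u i

/-- The sample counterpart of `W̄_k`. -/
def wHat (cell : Fin K → Set (Vec dz)) (z : Fin n → Vec dz) (x : Fin n → Vec dx) (k : Fin K) :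
    Idx dz dx → ℝ :=
  stack 1 (cellAvg cell z z k) (cellAvg cell z x k)

/-- The 2SLS residuals `Y_i - (1, Z_i', X_i') θ̂`. -/
def resid (cell : Fin K → Set (Vec dz)) (y : Fin n → ℝ) (z : Fin n → Vec dz)
    (x : Fin n → Vec dx) (i : Fin n) : ℝ :=
  y i - ∑ j, stack 1 (z i) (x i) j * tsls cell y z x j

/-- Estimated cell error variance: the average of the squared 2SLS residuals in cell `k`. -/
def sigmaSqHat (cell : Fin K → Set (Vec dz)) (y : Fin n → ℝ) (z : Fin n → Vec dz)
    (x : Fin n → Vec dx) (k : Fin K) : ℝ :=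
  cellAvg cell z (fun i => resid cell y z x i ^ 2) k

/-- The plug-in variance estimator. -/
def vHat (cell : Fin K → Set (Vec dz)) (y : Fin n → ℝ) (z : Fin n → Vec dz)
    (x : Fin n → Vec dx) : Matrix (Idx dz dx) (Idx dz dx) ℝ :=
  sandwich (pHat cell z) (sigmaSqHat cell y z x) (wHat cell z x)

/-- Pooled estimator of a common error variance: the average of all squared 2SLS residuals. -/
def pooledSigmaSqHat (cell : Fin K → Set (Vec dz)) (y : Fin n → ℝ) (z : Fin n → Vec dz)
    (x : Fin n → Vec dx) : ℝ :=
  (n : ℝ)⁻¹ * ∑ i, resid cell y z x i ^ 2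

end Sample

end DiscIV

end

/-! Projecting on cell dummies replaces each regressor row by its sample cell mean. With Ŵ the
matrix of sample cell means, Ĝ = `gram` of the sample shares and means, G its population
counterpart, and D'D = diag(n_k), one gets W̃'P_D = Ŵ'D' and W̃'P_D W̃ = n Ĝ. Hence, once every cell
is occupied and Ĝ is invertible, θ̂ - θ₀ = Ĝ⁻¹ Ŵ' S_n, where S_n has entries n⁻¹ ∑_i D_{ik} ε_i
(`tsls_eq_add`).

The strong law gives Ĝ → G and Ŵ → W̄ almost surely. The rank condition makes G = W̄' diag(p) W̄
positive definite, so inversion is continuous there. The summands of S_n are centred because E[ε |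
Z] = 0, and their coordinates are uncorrelated because the cells are disjoint; thus √n S_n has the
Gaussian limit with covariance diag(p_k σ_k²) (`tendstoInDistribution_score`). Slutsky's theorem
(`tendstoInDistribution_mulVec`) carries this through Ĝ⁻¹ Ŵ', and the resulting covariance is the
sandwich (`sandwich_eq_mul_diagonal_mul`).

Well-definedness and consistency are deterministic consequences of `MomentLimits` along one sample
path; probability enters them through `ae_momentLimits`, and the pooled variance also uses that
almost surely every observation falls in a cell. -/

noncomputable section

namespace DiscIV

/-! ### Algebra and continuity of the Gram and sandwich matrices -/

section Algebra

variable {dz dx K n : ℕ}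

lemma gram_eq_mul (p : Fin K → ℝ) (W : Fin K → Idx dz dx → ℝ) :
    gram p W = (Matrix.of W).transpose * Matrix.diagonal p * Matrix.of W := by
  ext a b
  rw [Matrix.mul_apply]
  simp only [gram, Matrix.sum_apply, Matrix.smul_apply, Matrix.vecMulVec_apply, smul_eq_mul,
    Matrix.mul_diagonal, Matrix.transpose_apply, Matrix.of_apply]
  exact Finset.sum_congr rfl fun k _ => by ring

lemma gram_smul (c : ℝ) (p : Fin K → ℝ) (W : Fin K → Idx dz dx → ℝ) :
    gram (fun k => c * p k) W = c • gram p W := by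
  simp [gram, Finset.smul_sum, smul_smul]

lemma gram_posSemidef {p : Fin K → ℝ} (hp : ∀ k, 0 ≤ p k) (W : Fin K → Idx dz dx → ℝ) :
    (gram p W).PosSemidef := by
  rw [gram_eq_mul, ← Matrix.conjTranspose_eq_transpose_of_trivial]
  exact (Matrix.PosSemidef.diagonal hp).conjTranspose_mul_mul_same _

/-- Full column rank makes W injective, so W' diag(p) W inherits positive definiteness from the
positive diagonal. -/
lemma isUnit_gram {p : Fin K → ℝ} (hp : ∀ k, 0 < p k) {W : Fin K → Idx dz dx → ℝ}
    (hW : (Matrix.of W).rank = 1 + dz + dx) : IsUnit (gram p W) := by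
  have hinj : Function.Injective (Matrix.of W).mulVec := by
    rw [Matrix.mulVec_injective_iff, linearIndependent_iff_card_eq_finrank_span]
    rw [Matrix.rank_eq_finrank_span_cols] at hW
    simp only [Set.finrank]
    rw [hW]
    simp [add_assoc]
  rw [gram_eq_mul, ← Matrix.conjTranspose_eq_transpose_of_trivial]
  exact ((Matrix.PosDef.diagonal hp).conjTranspose_mul_mul_same hinj).isUnit

lemma gram_inv_transpose (p : Fin K → ℝ) (W : Fin K → Idx dz dx → ℝ) :
    ((gram p W)⁻¹).transpose = (gram p W)⁻¹ := by
  rw [Matrix.transpose_nonsing_inv, gram_eq_mul]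
  simp [Matrix.transpose_mul, Matrix.mul_assoc]

/-- The outer factors are symmetric, so the sandwich is a congruence transform of a weighted Gram
matrix. -/
lemma sandwich_posSemidef {p s : Fin K → ℝ} (hp : ∀ k, 0 ≤ p k) (hs : ∀ k, 0 ≤ s k)
    (W : Fin K → Idx dz dx → ℝ) : (sandwich p s W).PosSemidef := by
  have h := (gram_posSemidef (fun k => mul_nonneg (hp k) (hs k)) W).conjTranspose_mul_mul_same
    (gram p W)⁻¹
  rwa [Matrix.conjTranspose_eq_transpose_of_trivial, gram_inv_transpose] at h

/-- Under homoskedasticity the sandwich collapses. -/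
lemma sandwich_eq_smul_inv {p s : Fin K → ℝ} {W : Fin K → Idx dz dx → ℝ}
    (hG : IsUnit (gram p W)) {c : ℝ} (hs : ∀ k, s k = c) :
    sandwich p s W = c • (gram p W)⁻¹ := by
  have h : (fun k => p k * s k) = fun k => c * p k := by
    funext k
    rw [hs, mul_comm]
  rw [sandwich, h, gram_smul, Matrix.mul_smul, Matrix.smul_mul,
    Matrix.nonsing_inv_mul _ ((Matrix.isUnit_iff_isUnit_det _).1 hG), Matrix.one_mul]

/-- The sandwich as the covariance matrix of a linear image of uncorrelated coordinates. -/
lemma sandwich_eq_mul_diagonal_mul (p s : Fin K → ℝ) (W : Fin K → Idx dz dx → ℝ) :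
    sandwich p s W = ((gram p W)⁻¹ * (Matrix.of W).transpose) *
      Matrix.diagonal (fun k => p k * s k) *
      ((gram p W)⁻¹ * (Matrix.of W).transpose).transpose := by
  rw [Matrix.transpose_mul, Matrix.transpose_transpose, gram_inv_transpose, sandwich,
    gram_eq_mul (fun k => p k * s k)]
  simp only [Matrix.mul_assoc]

lemma tendsto_gram {ι : Type*} {l : Filter ι} {p : ι → Fin K → ℝ} {p₀ : Fin K → ℝ}
    {W : ι → Fin K → Idx dz dx → ℝ} {W₀ : Fin K → Idx dz dx → ℝ}
    (hp : ∀ k, Tendsto (fun i => p i k) l (𝓝 (p₀ k)))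
    (hW : ∀ k j, Tendsto (fun i => W i k j) l (𝓝 (W₀ k j))) :
    Tendsto (fun i => gram (p i) (W i)) l (𝓝 (gram p₀ W₀)) := by
  refine tendsto_pi_nhds.2 fun a => tendsto_pi_nhds.2 fun b => ?_
  simp only [gram, Matrix.sum_apply, Matrix.smul_apply, Matrix.vecMulVec_apply, smul_eq_mul]
  exact tendsto_finsetSum _ fun k _ => (hp k).mul ((hW k a).mul (hW k b))

lemma tendsto_matrix_inv {ι m : Type*} [Fintype m] [DecidableEq m] {l : Filter ι}
    {A : ι → Matrix m m ℝ} {A₀ : Matrix m m ℝ} (hA : Tendsto A l (𝓝 A₀)) (hu : IsUnit A₀) :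
    Tendsto (fun i => (A i)⁻¹) l (𝓝 A₀⁻¹) := by
  refine (continuousAt_matrix_inv A₀ ?_).tendsto.comp hA
  have h := (Matrix.isUnit_iff_isUnit_det _).1 hu
  simpa using NormedRing.inverse_continuousAt h.unit

lemma tendsto_matrix_mul {ι l m r : Type*} [Fintype m] {f : Filter ι}
    {A : ι → Matrix l m ℝ} {A₀ : Matrix l m ℝ} {B : ι → Matrix m r ℝ} {B₀ : Matrix m r ℝ}
    (hA : Tendsto A f (𝓝 A₀)) (hB : Tendsto B f (𝓝 B₀)) :
    Tendsto (fun i => A i * B i) f (𝓝 (A₀ * B₀)) := by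
  refine tendsto_pi_nhds.2 fun a => tendsto_pi_nhds.2 fun b => ?_
  simp only [Matrix.mul_apply]
  exact tendsto_finsetSum _ fun k _ => (tendsto_pi_nhds.1 (tendsto_pi_nhds.1 hA a) k).mul
    (tendsto_pi_nhds.1 (tendsto_pi_nhds.1 hB k) b)

lemma eventually_isUnit_matrix {ι m : Type*} [Fintype m] [DecidableEq m] {l : Filter ι}
    {A : ι → Matrix m m ℝ} {A₀ : Matrix m m ℝ} (hA : Tendsto A l (𝓝 A₀)) (hu : IsUnit A₀) :
    ∀ᶠ i in l, IsUnit (A i) := by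
  have hdet : Tendsto (fun i => (A i).det) l (𝓝 A₀.det) :=
    (Continuous.matrix_det continuous_id).continuousAt.tendsto.comp hA
  have h := (Matrix.isUnit_iff_isUnit_det _).1 hu
  filter_upwards [hdet.eventually_ne h.ne_zero] with i hi
  exact (Matrix.isUnit_iff_isUnit_det _).2 (isUnit_iff_ne_zero.2 hi)

lemma tendsto_sandwich {ι : Type*} {l : Filter ι} {p s : ι → Fin K → ℝ} {p₀ s₀ : Fin K → ℝ}
    {W : ι → Fin K → Idx dz dx → ℝ} {W₀ : Fin K → Idx dz dx → ℝ}
    (hp : ∀ k, Tendsto (fun i => p i k) l (𝓝 (p₀ k)))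
    (hs : ∀ k, Tendsto (fun i => s i k) l (𝓝 (s₀ k)))
    (hW : ∀ k j, Tendsto (fun i => W i k j) l (𝓝 (W₀ k j))) (hu : IsUnit (gram p₀ W₀)) :
    Tendsto (fun i => sandwich (p i) (s i) (W i)) l (𝓝 (sandwich p₀ s₀ W₀)) := by
  have h1 := tendsto_matrix_inv (tendsto_gram hp hW) hu
  have h2 := tendsto_gram (fun k => (hp k).mul (hs k)) hW
  exact (h1.mul h2).mul h1

/-! ### Finite-sample algebra of 2SLS with cell dummies -/

variable {cell : Fin K → Set (Vec dz)} {y : Fin n → ℝ} {z : Fin n → Vec dz} {x : Fin n → Vec dx}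

lemma dummies_mul_dummies (hdisj : Pairwise (Function.onFun Disjoint cell)) (i : Fin n)
    (k l : Fin K) :
    dummies cell z i k * dummies cell z i l = if k = l then dummies cell z i k else 0 := by
  classical
  by_cases hkl : k = l
  · subst hkl
    by_cases h : z i ∈ cell k <;> simp [dummies, h]
  · rw [if_neg hkl]
    by_cases h : z i ∈ cell k
    · have h' : z i ∉ cell l := fun h' => Set.disjoint_left.1 (hdisj hkl) h h'
      simp [dummies, h']
    · simp [dummies, h]

lemma dummies_transpose_mul_self (hdisj : Pairwise (Function.onFun Disjoint cell)) :
    (dummies cell z).transpose * dummies cell z = Matrix.diagonal (cellCount cell z) := by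
  ext k l
  simp only [Matrix.mul_apply, Matrix.transpose_apply, dummies_mul_dummies hdisj,
    Matrix.diagonal_apply, cellCount]
  split_ifs <;> simp

/-- Occupancy of the cell matters only for the constant coordinate: it is 1 on the left, but 0⁻¹ * 0
= 0 on the right in an empty cell. -/
lemma wHat_apply {k : Fin K} (hk : cellCount cell z k ≠ 0) (j : Idx dz dx) :
    wHat cell z x k j =
      (cellCount cell z k)⁻¹ * ∑ i, dummies cell z i k * stack 1 (z i) (x i) j := by
  rcases j with _ | j | j
  · simpa [wHat, stack, cellCount] using (inv_mul_cancel₀ hk).symm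
  · simp [wHat, stack, cellAvg, WithLp.ofLp_sum]
  · simp [wHat, stack, cellAvg, WithLp.ofLp_sum]

lemma dummies_transpose_mul_regressors (hn : ∀ k, cellCount cell z k ≠ 0) :
    (dummies cell z).transpose * regressors z x =
      Matrix.diagonal (cellCount cell z) * Matrix.of (wHat cell z x) := by
  ext k j
  rw [Matrix.diagonal_mul, Matrix.of_apply, wHat_apply (hn k), mul_inv_cancel_left₀ (hn k)]
  simp [Matrix.mul_apply, regressors]

/-- The first stage regresses on dummies: W̃'D = Ŵ' diag(n_k), and (D'D)⁻¹ cancels the counts,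
leaving the fitted values as cell means. -/
lemma regressors_transpose_mul_projD (hdisj : Pairwise (Function.onFun Disjoint cell))
    (hn : ∀ k, cellCount cell z k ≠ 0) :
    (regressors z x).transpose * projD (dummies cell z) =
      (Matrix.of (wHat cell z x)).transpose * (dummies cell z).transpose := by
  have hu : IsUnit (Matrix.diagonal (cellCount cell z)).det := by
    rw [Matrix.det_diagonal]
    exact isUnit_iff_ne_zero.2 (Finset.prod_ne_zero_iff.2 fun k _ => hn k)
  have h : (regressors z x).transpose * dummies cell z =
      (Matrix.of (wHat cell z x)).transpose * Matrix.diagonal (cellCount cell z) := by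
    have := congrArg Matrix.transpose (dummies_transpose_mul_regressors (x := x) hn)
    simpa [Matrix.transpose_mul] using this
  rw [projD, dummies_transpose_mul_self hdisj, ← Matrix.mul_assoc, ← Matrix.mul_assoc, h,
    Matrix.mul_nonsing_inv_cancel_right _ _ hu]

lemma gram_cellCount (hn0 : n ≠ 0) :
    gram (cellCount cell z) (wHat cell z x) = (n : ℝ) • gram (pHat cell z) (wHat cell z x) := by
  rw [← gram_smul]
  congr 1
  funext k
  rw [pHat, mul_div_cancel₀ _ (Nat.cast_ne_zero.2 hn0)]

lemma regressors_projD_regressors (hdisj : Pairwise (Function.onFun Disjoint cell))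
    (hn : ∀ k, cellCount cell z k ≠ 0) (hn0 : n ≠ 0) :
    (regressors z x).transpose * projD (dummies cell z) * regressors z x =
      (n : ℝ) • gram (pHat cell z) (wHat cell z x) := by
  rw [regressors_transpose_mul_projD hdisj hn, Matrix.mul_assoc,
    dummies_transpose_mul_regressors hn, ← gram_cellCount hn0, gram_eq_mul, Matrix.mul_assoc]

lemma tslsWellDefined_of_isUnit (hdisj : Pairwise (Function.onFun Disjoint cell))
    (hn : ∀ k, cellCount cell z k ≠ 0) (hn0 : n ≠ 0)
    (hu : IsUnit (gram (pHat cell z) (wHat cell z x))) : TslsWellDefined cell z x := by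
  constructor
  · rw [dummies_transpose_mul_self hdisj, Matrix.isUnit_iff_isUnit_det, Matrix.det_diagonal]
    exact isUnit_iff_ne_zero.2 (Finset.prod_ne_zero_iff.2 fun k _ => hn k)
  · rw [regressors_projD_regressors hdisj hn hn0]
    rw [Matrix.isUnit_iff_isUnit_det] at hu ⊢
    rw [Matrix.det_smul]
    exact ((isUnit_iff_ne_zero.2 (Nat.cast_ne_zero.2 hn0)).pow _).mul hu

/-- The sampling error of two-stage least squares is linear in the cell averages of the errors. -/
lemma tsls_eq_add (hdisj : Pairwise (Function.onFun Disjoint cell))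
    (hn : ∀ k, cellCount cell z k ≠ 0) (hn0 : n ≠ 0)
    (hu : IsUnit (gram (pHat cell z) (wHat cell z x))) {θ : Idx dz dx → ℝ} {e : Fin n → ℝ}
    (hy : y = (regressors z x).mulVec θ + e) :
    tsls cell y z x = WithLp.toLp 2 (θ + ((gram (pHat cell z) (wHat cell z x))⁻¹ *
      (Matrix.of (wHat cell z x)).transpose).mulVec
        fun k => (n : ℝ)⁻¹ * ∑ i, dummies cell z i k * e i) := by
  have hn' : (n : ℝ) ≠ 0 := Nat.cast_ne_zero.2 hn0
  have hdet := (Matrix.isUnit_iff_isUnit_det _).1 hu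
  have hun : IsUnit ((n : ℝ) • gram (pHat cell z) (wHat cell z x)).det := by
    rw [Matrix.det_smul]
    exact ((isUnit_iff_ne_zero.2 hn').pow _).mul hdet
  have hS : (fun k => (n : ℝ)⁻¹ * ∑ i, dummies cell z i k * e i) =
      (n : ℝ)⁻¹ • (dummies cell z).transpose.mulVec e := by
    funext k
    simp [Matrix.mulVec, dotProduct]
  simp only [tsls]
  congr 1
  rw [hy, Matrix.mulVec_add, Matrix.mulVec_mulVec, Matrix.mul_assoc _ (Matrix.transpose _),
    Matrix.mul_assoc _ _ (regressors z x), regressors_projD_regressors hdisj hn hn0,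
    Matrix.nonsing_inv_mul _ hun, Matrix.one_mulVec, regressors_transpose_mul_projD hdisj hn, hS,
    Matrix.mulVec_smul, Matrix.mulVec_mulVec, Matrix.mul_assoc]
  congr 1
  -- What remains is (n Ĝ)⁻¹ = n⁻¹ Ĝ⁻¹, which accounts for the n⁻¹ in the averaged errors.
  rw [← Matrix.smul_mulVec, ← Matrix.smul_mul]
  congr 2
  have : Invertible (n : ℝ) := invertibleOfNonzero hn'
  rw [Matrix.inv_smul _ _ hdet, invOf_eq_inv]

end Algebra

/-! ### Consistency along a fixed sample path -/

section Limits

variable {dz dx K : ℕ}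

/-- The indicator of cell `k`, as a real function. -/
def cellInd (cell : Fin K → Set (Vec dz)) (k : Fin K) (v : Vec dz) : ℝ :=
  (cell k).indicator (fun _ => (1 : ℝ)) v

/-- Convergence along one sample path of the cell averages from which the estimators are built. -/
structure MomentLimits (cell : Fin K → Set (Vec dz)) (z : ℕ → Vec dz) (x : ℕ → Vec dx)
    (e : ℕ → ℝ) (p : Fin K → ℝ) (W : Fin K → Idx dz dx → ℝ) (s : Fin K → ℝ) : Prop where
  count : ∀ k, Tendsto (fun n : ℕ => (n : ℝ)⁻¹ * ∑ i : Fin n, cellInd cell k (z i)) atTop (𝓝 (p k))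
  reg : ∀ k j, Tendsto (fun n : ℕ => (n : ℝ)⁻¹ * ∑ i : Fin n,
    cellInd cell k (z i) * stack 1 (z i) (x i) j) atTop (𝓝 (p k * W k j))
  err : ∀ k, Tendsto (fun n : ℕ => (n : ℝ)⁻¹ * ∑ i : Fin n, cellInd cell k (z i) * e i) atTop (𝓝 0)
  errSq : ∀ k, Tendsto (fun n : ℕ => (n : ℝ)⁻¹ * ∑ i : Fin n, cellInd cell k (z i) * e i ^ 2)
    atTop (𝓝 (p k * s k))
  -- The values of these last limits are irrelevant: the averages only appear multiplied by an
  -- estimation error tending to zero.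
  errReg : ∀ k j, ∃ c, Tendsto (fun n : ℕ => (n : ℝ)⁻¹ * ∑ i : Fin n,
    cellInd cell k (z i) * (e i * stack 1 (z i) (x i) j)) atTop (𝓝 c)
  regReg : ∀ k j l, ∃ c, Tendsto (fun n : ℕ => (n : ℝ)⁻¹ * ∑ i : Fin n,
    cellInd cell k (z i) * (stack 1 (z i) (x i) j * stack 1 (z i) (x i) l)) atTop (𝓝 c)

namespace MomentLimits

variable {cell : Fin K → Set (Vec dz)} {z : ℕ → Vec dz} {x : ℕ → Vec dx} {e : ℕ → ℝ}
  {p s : Fin K → ℝ} {W : Fin K → Idx dz dx → ℝ}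

lemma tendsto_pHat (h : MomentLimits cell z x e p W s) (k : Fin K) :
    Tendsto (fun n : ℕ => pHat cell (fun i : Fin n => z i) k) atTop (𝓝 (p k)) := by
  refine (h.count k).congr fun n => ?_
  rw [pHat, div_eq_inv_mul]
  rfl

lemma eventually_cellCount_ne_zero (h : MomentLimits cell z x e p W s) (hp : ∀ k, 0 < p k) :
    ∀ᶠ n : ℕ in atTop, ∀ k, cellCount cell (fun i : Fin n => z i) k ≠ 0 := by
  refine eventually_all.2 fun k => ?_
  filter_upwards [(h.tendsto_pHat k).eventually_ne (hp k).ne'] with n hn hc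
  exact hn (by simp [pHat, hc])

lemma tendsto_wHat (h : MomentLimits cell z x e p W s) (hp : ∀ k, 0 < p k) (k : Fin K)
    (j : Idx dz dx) :
    Tendsto (fun n : ℕ => wHat cell (fun i : Fin n => z i) (fun i : Fin n => x i) k j) atTop
      (𝓝 (W k j)) := by
  have h1 := ((h.count k).inv₀ (hp k).ne').mul (h.reg k j)
  rw [inv_mul_cancel_left₀ (hp k).ne'] at h1
  refine h1.congr' ?_
  filter_upwards [h.eventually_cellCount_ne_zero hp, eventually_ne_atTop 0] with n hn hn0
  have hn' : (n : ℝ) ≠ 0 := Nat.cast_ne_zero.2 hn0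
  -- A cell mean is a ratio of two full-sample averages; their factors n⁻¹ cancel.
  rw [wHat_apply (hn k), mul_inv, inv_inv, mul_mul_mul_comm, mul_inv_cancel₀ hn', one_mul]
  rfl

lemma tendsto_gram_hat (h : MomentLimits cell z x e p W s) (hp : ∀ k, 0 < p k) :
    Tendsto (fun n : ℕ => gram (pHat cell fun i : Fin n => z i)
      (wHat cell (fun i : Fin n => z i) fun i : Fin n => x i)) atTop (𝓝 (gram p W)) :=
  tendsto_gram h.tendsto_pHat (h.tendsto_wHat hp)

lemma tendsto_gram_inv_mul (h : MomentLimits cell z x e p W s) (hp : ∀ k, 0 < p k)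
    (hu : IsUnit (gram p W)) :
    Tendsto (fun n : ℕ => (gram (pHat cell fun i : Fin n => z i)
      (wHat cell (fun i : Fin n => z i) fun i : Fin n => x i))⁻¹ *
      (Matrix.of (wHat cell (fun i : Fin n => z i) fun i : Fin n => x i)).transpose) atTop
      (𝓝 ((gram p W)⁻¹ * (Matrix.of W).transpose)) := by
  have hW : Tendsto (fun n : ℕ => (Matrix.of
      (wHat cell (fun i : Fin n => z i) fun i : Fin n => x i)).transpose) atTop
      (𝓝 (Matrix.of W).transpose) :=
    tendsto_pi_nhds.2 fun j => tendsto_pi_nhds.2 fun k => h.tendsto_wHat hp k j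
  exact tendsto_matrix_mul (tendsto_matrix_inv (h.tendsto_gram_hat hp) hu) hW

lemma eventually_isUnit (h : MomentLimits cell z x e p W s) (hp : ∀ k, 0 < p k)
    (hu : IsUnit (gram p W)) :
    ∀ᶠ n : ℕ in atTop, n ≠ 0 ∧ (∀ k, cellCount cell (fun i : Fin n => z i) k ≠ 0) ∧
      IsUnit (gram (pHat cell fun i : Fin n => z i)
        (wHat cell (fun i : Fin n => z i) fun i : Fin n => x i)) := by
  filter_upwards [h.eventually_cellCount_ne_zero hp, eventually_ne_atTop 0,
    eventually_isUnit_matrix (h.tendsto_gram_hat hp) hu] with n h1 h2 h3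
  exact ⟨h2, h1, h3⟩

lemma eventually_tslsWellDefined (h : MomentLimits cell z x e p W s) (hp : ∀ k, 0 < p k)
    (hu : IsUnit (gram p W)) (hdisj : Pairwise (Function.onFun Disjoint cell)) :
    ∀ᶠ n : ℕ in atTop, TslsWellDefined cell (fun i : Fin n => z i) (fun i : Fin n => x i) := by
  filter_upwards [h.eventually_isUnit hp hu] with n hn
  exact tslsWellDefined_of_isUnit hdisj hn.2.1 hn.1 hn.2.2

variable {y : ℕ → ℝ} {θ : Idx dz dx → ℝ}

lemma eventually_tsls_eq (h : MomentLimits cell z x e p W s) (hp : ∀ k, 0 < p k)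
    (hu : IsUnit (gram p W)) (hdisj : Pairwise (Function.onFun Disjoint cell))
    (hy : ∀ i, y i = ∑ j, stack 1 (z i) (x i) j * θ j + e i) :
    ∀ᶠ n : ℕ in atTop, tsls cell (fun i : Fin n => y i) (fun i : Fin n => z i)
      (fun i : Fin n => x i) = WithLp.toLp 2 (θ + ((gram (pHat cell fun i : Fin n => z i)
        (wHat cell (fun i : Fin n => z i) fun i : Fin n => x i))⁻¹ *
        (Matrix.of (wHat cell (fun i : Fin n => z i) fun i : Fin n => x i)).transpose).mulVec
        fun k => (n : ℝ)⁻¹ * ∑ i : Fin n, cellInd cell k (z i) * e i) := by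
  filter_upwards [h.eventually_isUnit hp hu] with n hn
  refine tsls_eq_add hdisj hn.2.1 hn.1 hn.2.2 (e := fun i : Fin n => e i) ?_
  funext i
  exact hy i

lemma tendsto_tsls (h : MomentLimits cell z x e p W s) (hp : ∀ k, 0 < p k)
    (hu : IsUnit (gram p W)) (hdisj : Pairwise (Function.onFun Disjoint cell))
    (hy : ∀ i, y i = ∑ j, stack 1 (z i) (x i) j * θ j + e i) (j : Idx dz dx) :
    Tendsto (fun n : ℕ => tsls cell (fun i : Fin n => y i) (fun i : Fin n => z i)
      (fun i : Fin n => x i) j) atTop (𝓝 (θ j)) := by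
  have h1 : Tendsto (fun n : ℕ => θ j + ∑ k, ((gram (pHat cell fun i : Fin n => z i)
        (wHat cell (fun i : Fin n => z i) fun i : Fin n => x i))⁻¹ *
        (Matrix.of (wHat cell (fun i : Fin n => z i) fun i : Fin n => x i)).transpose) j k *
        ((n : ℝ)⁻¹ * ∑ i : Fin n, cellInd cell k (z i) * e i)) atTop
      (𝓝 (θ j + ∑ k, ((gram p W)⁻¹ * (Matrix.of W).transpose) j k * 0)) := by
    refine tendsto_const_nhds.add (tendsto_finsetSum _ fun k _ => Tendsto.mul ?_ (h.err k))
    exact tendsto_pi_nhds.1 (tendsto_pi_nhds.1 (h.tendsto_gram_inv_mul hp hu) j) k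
  simp only [mul_zero, Finset.sum_const_zero, add_zero] at h1
  refine h1.congr' ?_
  filter_upwards [h.eventually_tsls_eq hp hu hdisj hy] with n hn
  rw [hn]
  rfl

/-- Each residual is e_i - δ_n'w_i with δ_n = θ̂ - θ → 0. Expanding the square gives the average of
e_i² plus terms linear and quadratic in δ_n, whose coefficients are convergent averages; these terms
vanish in the limit. -/
lemma tendsto_avg_resid_sq (h : MomentLimits cell z x e p W s) (hp : ∀ k, 0 < p k)
    (hu : IsUnit (gram p W)) (hdisj : Pairwise (Function.onFun Disjoint cell))
    (hy : ∀ i, y i = ∑ j, stack 1 (z i) (x i) j * θ j + e i) (k : Fin K) :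
    Tendsto (fun n : ℕ => (n : ℝ)⁻¹ * ∑ i : Fin n, cellInd cell k (z i) *
      resid cell (fun i : Fin n => y i) (fun i : Fin n => z i) (fun i : Fin n => x i) i ^ 2)
      atTop (𝓝 (p k * s k)) := by
  choose c hc using h.errReg
  choose M hM using h.regReg
  set δ : ℕ → Idx dz dx → ℝ := fun n j => tsls cell (fun i : Fin n => y i)
    (fun i : Fin n => z i) (fun i : Fin n => x i) j - θ j with hδ
  have hδ0 : ∀ j, Tendsto (fun n => δ n j) atTop (𝓝 0) := fun j => by
    simpa using (h.tendsto_tsls hp hu hdisj hy j).sub_const (θ j)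
  have key : Tendsto (fun n : ℕ =>
      (n : ℝ)⁻¹ * ∑ i : Fin n, cellInd cell k (z i) * e i ^ 2
      - 2 * ∑ j, δ n j * ((n : ℝ)⁻¹ * ∑ i : Fin n,
          cellInd cell k (z i) * (e i * stack 1 (z i) (x i) j))
      + ∑ j, ∑ l, δ n j * δ n l * ((n : ℝ)⁻¹ * ∑ i : Fin n,
          cellInd cell k (z i) * (stack 1 (z i) (x i) j * stack 1 (z i) (x i) l))) atTop
      (𝓝 (p k * s k - 2 * ∑ j, 0 * c k j + ∑ j, ∑ l, 0 * 0 * M k j l)) := by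
    refine ((h.errSq k).sub (Tendsto.const_mul 2 (tendsto_finsetSum _ fun j _ => ?_))).add
      (tendsto_finsetSum _ fun j _ => tendsto_finsetSum _ fun l _ => ?_)
    · exact (hδ0 j).mul (hc k j)
    · exact ((hδ0 j).mul (hδ0 l)).mul (hM k j l)
  simp only [zero_mul, mul_zero, Finset.sum_const_zero, sub_zero, add_zero] at key
  refine key.congr fun n => ?_
  have hres : ∀ i : Fin n, resid cell (fun i : Fin n => y i) (fun i : Fin n => z i)
      (fun i : Fin n => x i) i = e i - ∑ j, δ n j * stack 1 (z i) (x i) j := fun i => by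
    simp only [resid, hδ, hy, sub_mul, Finset.sum_sub_distrib]
    have h1 : ∀ f g : Idx dz dx → ℝ, ∑ j, f j * g j = ∑ j, g j * f j := fun f g =>
      Finset.sum_congr rfl fun j _ => mul_comm _ _
    rw [h1 (stack 1 (z i) (x i)) θ, h1 (stack 1 (z i) (x i))]
    ring
  have hsq : ∀ i : Fin n, resid cell (fun i : Fin n => y i) (fun i : Fin n => z i)
      (fun i : Fin n => x i) i ^ 2 = e i ^ 2 - 2 * ∑ j, δ n j * (e i * stack 1 (z i) (x i) j)
        + ∑ j, ∑ l, δ n j * δ n l * (stack 1 (z i) (x i) j * stack 1 (z i) (x i) l) := fun i => by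
    have h2 : ∑ j, ∑ l, δ n j * δ n l * (stack 1 (z i) (x i) j * stack 1 (z i) (x i) l) =
        (∑ j, δ n j * stack 1 (z i) (x i) j) ^ 2 := by
      rw [sq, Finset.sum_mul_sum]
      exact Finset.sum_congr rfl fun j _ => Finset.sum_congr rfl fun l _ => by ring
    have h3 : ∑ j, δ n j * (e i * stack 1 (z i) (x i) j) =
        e i * ∑ j, δ n j * stack 1 (z i) (x i) j := by
      rw [Finset.mul_sum]
      exact Finset.sum_congr rfl fun j _ => by ring
    rw [hres, h2, h3]
    ring
  simp only [hsq, mul_add, mul_sub, Finset.sum_add_distrib, Finset.sum_sub_distrib]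
  congr 1
  · congr 1
    simp only [Finset.mul_sum]
    rw [Finset.sum_comm]
    exact Finset.sum_congr rfl fun i _ => Finset.sum_congr rfl fun j _ => by ring
  · simp only [Finset.mul_sum]
    rw [Finset.sum_comm_cycle]
    refine Finset.sum_congr rfl fun i _ => ?_
    exact Finset.sum_congr rfl fun j _ => Finset.sum_congr rfl fun l _ => by ring

lemma tendsto_sigmaSqHat (h : MomentLimits cell z x e p W s) (hp : ∀ k, 0 < p k)
    (hu : IsUnit (gram p W)) (hdisj : Pairwise (Function.onFun Disjoint cell))
    (hy : ∀ i, y i = ∑ j, stack 1 (z i) (x i) j * θ j + e i) (k : Fin K) :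
    Tendsto (fun n : ℕ => sigmaSqHat cell (fun i : Fin n => y i) (fun i : Fin n => z i)
      (fun i : Fin n => x i) k) atTop (𝓝 (s k)) := by
  have h1 := ((h.count k).inv₀ (hp k).ne').mul (h.tendsto_avg_resid_sq hp hu hdisj hy k)
  rw [inv_mul_cancel_left₀ (hp k).ne'] at h1
  refine h1.congr' ?_
  filter_upwards [eventually_ne_atTop 0] with n hn0
  have hn' : (n : ℝ) ≠ 0 := Nat.cast_ne_zero.2 hn0
  rw [mul_inv, inv_inv, mul_mul_mul_comm, mul_inv_cancel₀ hn', one_mul]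
  rfl

lemma tendsto_vHat (h : MomentLimits cell z x e p W s) (hp : ∀ k, 0 < p k)
    (hu : IsUnit (gram p W)) (hdisj : Pairwise (Function.onFun Disjoint cell))
    (hy : ∀ i, y i = ∑ j, stack 1 (z i) (x i) j * θ j + e i) :
    Tendsto (fun n : ℕ => vHat cell (fun i : Fin n => y i) (fun i : Fin n => z i)
      (fun i : Fin n => x i)) atTop (𝓝 (sandwich p s W)) :=
  tendsto_sandwich h.tendsto_pHat (h.tendsto_sigmaSqHat hp hu hdisj hy) (h.tendsto_wHat hp) hu

lemma sum_cellInd (hdisj : Pairwise (Function.onFun Disjoint cell)) {v : Vec dz}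
    (hv : v ∈ ⋃ k, cell k) : ∑ k, cellInd cell k v = 1 := by
  obtain ⟨k, hk⟩ := Set.mem_iUnion.1 hv
  rw [Finset.sum_eq_single k]
  · simp [cellInd, hk]
  · intro l _ hl
    have : v ∉ cell l := fun h' => Set.disjoint_left.1 (hdisj hl) h' hk
    simp [cellInd, this]
  · simp

/-- Since every observation lies in exactly one cell, the pooled average is the sum over cells of
the averages of `tendsto_avg_resid_sq`, with limit c ∑ p_k. -/
lemma tendsto_pooledSigmaSqHat (h : MomentLimits cell z x e p W s) (hp : ∀ k, 0 < p k)
    (hu : IsUnit (gram p W)) (hdisj : Pairwise (Function.onFun Disjoint cell))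
    (hy : ∀ i, y i = ∑ j, stack 1 (z i) (x i) j * θ j + e i)
    (hcov : ∀ i, z i ∈ ⋃ k, cell k) {c : ℝ} (hs : ∀ k, s k = c) :
    Tendsto (fun n : ℕ => pooledSigmaSqHat cell (fun i : Fin n => y i) (fun i : Fin n => z i)
      (fun i : Fin n => x i)) atTop (𝓝 c) := by
  -- The sample shares sum to 1 for every n ≠ 0, so their limits do as well.
  have hp1 : ∑ k, p k = 1 := by
    refine tendsto_nhds_unique (tendsto_finsetSum Finset.univ fun k _ => h.count k)
      (tendsto_const_nhds.congr' ?_)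
    filter_upwards [eventually_ne_atTop 0] with n hn0
    have hn' : (n : ℝ) ≠ 0 := Nat.cast_ne_zero.2 hn0
    rw [← Finset.mul_sum, Finset.sum_comm,
      Finset.sum_congr rfl fun i _ => sum_cellInd hdisj (hcov _)]
    simp [hn']
  have h1 := tendsto_finsetSum Finset.univ fun k _ => h.tendsto_avg_resid_sq hp hu hdisj hy k
  simp only [hs, ← Finset.sum_mul, hp1, one_mul] at h1
  refine h1.congr fun n => ?_
  rw [← Finset.mul_sum, Finset.sum_comm, pooledSigmaSqHat]
  congr 1
  refine Finset.sum_congr rfl fun i _ => ?_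
  rw [← Finset.sum_mul, sum_cellInd hdisj (hcov _), one_mul]

end MomentLimits

end Limits

/-! ### Multivariate central limit theorem and linear images of Gaussians -/

section CentralLimit

/-- The multivariate central limit theorem for centred square-integrable vectors. -/
theorem tendstoInDistribution_inv_sqrt_smul_sum {Ω ι : Type*} [MeasurableSpace Ω]
    {P : Measure Ω} [IsProbabilityMeasure P] [Fintype ι] [DecidableEq ι]
    {U : ℕ → Ω → EuclideanSpace ℝ ι} (hindep : iIndepFun U P)
    (hident : ∀ i, IdentDistrib (U i) (U 0) P P) (hL2 : MemLp (U 0) 2 P)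
    {S : Matrix ι ι ℝ} (hS : S.PosSemidef)
    (hmean : ∀ t : EuclideanSpace ℝ ι, ∫ ω, inner ℝ (U 0 ω) t ∂P = 0)
    (hvar : ∀ t : EuclideanSpace ℝ ι,
      ∫ ω, inner ℝ (U 0 ω) t ^ 2 ∂P = t.ofLp ⬝ᵥ S.mulVec t.ofLp) :
    TendstoInDistribution (fun (n : ℕ) ω => (√(n : ℝ))⁻¹ • ∑ i ∈ Finset.range n, U i ω) atTop
      (id : EuclideanSpace ℝ ι → EuclideanSpace ℝ ι) (fun _ => P) (multivariateGaussian 0 S) where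
  forall_aemeasurable n :=
    (Finset.aemeasurable_fun_sum _ fun i _ => (hident i).aemeasurable_fst).fun_const_smul _
  tendsto := by
    -- Cramér–Wold through characteristic functions: that of the vector sum at t equals that of the
    -- scalar sum of the projections ⟨U_i, t⟩ at 1, to which the scalar central limit theorem
    -- applies.
    refine ProbabilityMeasure.tendsto_iff_tendsto_charFun.2 fun t => ?_
    have hm : Measurable fun u : EuclideanSpace ℝ ι => inner ℝ u t := by fun_prop
    have hT : ∀ n : ℕ, AEMeasurable
        (fun ω => (√(n : ℝ))⁻¹ • ∑ i ∈ Finset.range n, U i ω) P := fun n =>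
      (Finset.aemeasurable_fun_sum _ fun i _ => (hident i).aemeasurable_fst).fun_const_smul _
    have hX0 : ∫ ω, inner ℝ (U 0 ω) t ∂P = 0 := hmean t
    have hXL2 : MemLp (fun ω => inner ℝ (U 0 ω) t) 2 P := hL2.inner_const t
    have hXvar : Var[fun ω => inner ℝ (U 0 ω) t; P] = t.ofLp ⬝ᵥ S.mulVec t.ofLp := by
      rw [variance_of_integral_eq_zero hXL2.aestronglyMeasurable.aemeasurable hX0, ← hvar t]
    have hclt := tendstoInDistribution_inv_sqrt_mul_sum_sub (P := P)
      (P' := gaussianReal 0 Var[fun ω => inner ℝ (U 0 ω) t; P].toNNReal)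
      (X := fun i ω => inner ℝ (U i ω) t) (Y := id)
      ⟨aemeasurable_id, Measure.map_id⟩ hXL2
      (hindep.comp (fun _ u => inner ℝ u t) fun _ => hm) (fun i => (hident i).comp hm)
    have h1 := ProbabilityMeasure.tendsto_iff_tendsto_charFun.1 hclt.tendsto 1
    simp only [ProbabilityMeasure.coe_mk, Measure.map_id] at h1 ⊢
    rw [charFun_multivariateGaussian hS]
    rw [charFun_gaussianReal, hXvar] at h1
    have hnn : 0 ≤ t.ofLp ⬝ᵥ S.mulVec t.ofLp := by
      rw [← hXvar]
      exact variance_nonneg _ _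
    have hlim : Complex.exp (((1 : ℝ) : ℂ) * ((0 : ℝ) : ℂ) * Complex.I -
        (((t.ofLp ⬝ᵥ S.mulVec t.ofLp).toNNReal : ℝ) : ℂ) * ((1 : ℝ) : ℂ) ^ 2 / 2) =
        Complex.exp ((inner ℝ t (0 : EuclideanSpace ℝ ι) : ℝ) * Complex.I -
          ((t.ofLp ⬝ᵥ S.mulVec t.ofLp : ℝ) : ℂ) / 2) := by
      rw [Real.coe_toNNReal _ hnn]
      simp
    rw [← hlim]
    refine h1.congr fun n => ?_
    rw [charFun_apply, charFun_apply, integral_map (hT n) (by fun_prop),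
      integral_map (hclt.forall_aemeasurable n) (by fun_prop)]
    refine integral_congr_ae (ae_of_all _ fun ω => ?_)
    simp [real_inner_smul_left, sum_inner, hX0]

/-- By ⟨Av, t⟩ = ⟨v, A't⟩, the characteristic function of the image at t is the Gaussian one at A't,
whose quadratic form is t'(A S A')t. -/
lemma map_multivariateGaussian {ι κ : Type*} [Fintype ι] [DecidableEq ι] [Fintype κ]
    [DecidableEq κ] {S : Matrix ι ι ℝ} (hS : S.PosSemidef) (A : Matrix κ ι ℝ) :
    (multivariateGaussian 0 S).map (fun v => WithLp.toLp 2 (A.mulVec v.ofLp)) =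
      multivariateGaussian 0 (A * S * A.transpose) := by
  have hS' : (A * S * A.transpose).PosSemidef := by
    have := hS.mul_mul_conjTranspose_same A
    rwa [Matrix.conjTranspose_eq_transpose_of_trivial] at this
  have hm : Measurable fun v : EuclideanSpace ℝ ι => WithLp.toLp 2 (A.mulVec v.ofLp) := by
    have : Continuous fun v : EuclideanSpace ℝ ι => WithLp.toLp 2 (A.mulVec v.ofLp) := by fun_prop
    exact this.measurable
  have : IsProbabilityMeasure ((multivariateGaussian 0 S).map
      (fun v : EuclideanSpace ℝ ι => WithLp.toLp 2 (A.mulVec v.ofLp))) :=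
    Measure.isProbabilityMeasure_map hm.aemeasurable
  refine Measure.ext_of_charFun (funext fun t => ?_)
  have h : charFun ((multivariateGaussian 0 S).map
      (fun v => WithLp.toLp 2 (A.mulVec v.ofLp))) t =
      charFun (multivariateGaussian 0 S) (WithLp.toLp 2 (A.transpose.mulVec t.ofLp)) := by
    rw [charFun_apply, charFun_apply, integral_map hm.aemeasurable (by fun_prop)]
    refine integral_congr_ae (ae_of_all _ fun v => ?_)
    have hin : inner ℝ (WithLp.toLp 2 (A.mulVec v.ofLp)) t =
        inner ℝ v (WithLp.toLp 2 (A.transpose.mulVec t.ofLp)) := by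
      rw [EuclideanSpace.inner_eq_star_dotProduct, EuclideanSpace.inner_eq_star_dotProduct]
      simp [Matrix.dotProduct_mulVec, Matrix.mulVec_transpose]
    simp only [hin]
  rw [h, charFun_multivariateGaussian hS, charFun_multivariateGaussian hS']
  simp [← Matrix.mulVec_mulVec, Matrix.dotProduct_mulVec, Matrix.mulVec_transpose]

end CentralLimit

/-! ### Measurability of the estimators -/

section Measurability

variable {Ω : Type*} [MeasurableSpace Ω]

lemma measurable_matrix_mul_apply {l m r : Type*} [Fintype m] {A : Ω → Matrix l m ℝ}
    {B : Ω → Matrix m r ℝ} (hA : ∀ a b, Measurable fun ω => A ω a b)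
    (hB : ∀ a b, Measurable fun ω => B ω a b) (a : l) (b : r) :
    Measurable fun ω => (A ω * B ω) a b := by
  simp only [Matrix.mul_apply]
  exact Finset.measurable_fun_sum _ fun k _ => (hA a k).mul (hB k b)

lemma measurable_matrix_det {m : Type*} [Fintype m] [DecidableEq m] {A : Ω → Matrix m m ℝ}
    (hA : ∀ a b, Measurable fun ω => A ω a b) : Measurable fun ω => (A ω).det := by
  simp only [Matrix.det_apply']
  exact Finset.measurable_fun_sum _ fun σ _ =>
    (Finset.measurable_fun_prod _ fun i _ => hA _ _).const_mul _

/-- Entries of the inverse are det⁻¹ times cofactors. With 0⁻¹ = 0 this formula also covers singular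
matrices, so no invertibility is needed. -/
lemma measurable_matrix_inv_apply {m : Type*} [Fintype m] [DecidableEq m] {A : Ω → Matrix m m ℝ}
    (hA : ∀ a b, Measurable fun ω => A ω a b) (a b : m) : Measurable fun ω => (A ω)⁻¹ a b := by
  simp only [Matrix.inv_def, Ring.inverse_eq_inv', Matrix.smul_apply, smul_eq_mul,
    Matrix.adjugate_apply]
  refine (measurable_matrix_det hA).inv.mul (measurable_matrix_det fun c d => ?_)
  simp only [Matrix.updateRow_apply]
  split_ifs
  · exact measurable_const
  · exact hA c d

variable {dz dx K n : ℕ} {cell : Fin K → Set (Vec dz)}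

lemma measurable_cellInd (hcell : ∀ k, MeasurableSet (cell k)) (k : Fin K) :
    Measurable (cellInd cell k) :=
  measurable_const.indicator (hcell k)

lemma measurable_stack_apply {a : Ω → ℝ} {b : Ω → Vec dz} {c : Ω → Vec dx} (ha : Measurable a)
    (hb : Measurable b) (hc : Measurable c) (j : Idx dz dx) :
    Measurable fun ω => stack (a ω) (b ω) (c ω) j := by
  rcases j with _ | j | j <;> simp only [stack, Sum.elim_inl, Sum.elim_inr]
  · exact ha
  · fun_prop
  · fun_prop

variable {y : Fin n → Ω → ℝ} {z : Fin n → Ω → Vec dz} {x : Fin n → Ω → Vec dx}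

lemma measurable_dummies_apply (hcell : ∀ k, MeasurableSet (cell k)) (hz : ∀ i, Measurable (z i))
    (i : Fin n) (k : Fin K) : Measurable fun ω => dummies cell (fun i => z i ω) i k :=
  (measurable_cellInd hcell k).comp (hz i)

lemma measurable_tsls (hcell : ∀ k, MeasurableSet (cell k)) (hy : ∀ i, Measurable (y i))
    (hz : ∀ i, Measurable (z i)) (hx : ∀ i, Measurable (x i)) :
    Measurable fun ω => tsls cell (fun i => y i ω) (fun i => z i ω) (fun i => x i ω) := by
  have hD := measurable_dummies_apply (cell := cell) hcell hz
  have hDt : ∀ a b, Measurable fun ω => (dummies cell fun i => z i ω).transpose a b :=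
    fun a b => hD b a
  have hR : ∀ a b, Measurable fun ω =>
      regressors (fun i => z i ω) (fun i => x i ω) a b := fun a b =>
    measurable_stack_apply measurable_const (hz a) (hx a) b
  have hRt : ∀ a b, Measurable fun ω =>
      (regressors (fun i => z i ω) (fun i => x i ω)).transpose a b := fun a b => hR b a
  have hP : ∀ a b, Measurable fun ω => projD (dummies cell fun i => z i ω) a b :=
    measurable_matrix_mul_apply (measurable_matrix_mul_apply hD
      (measurable_matrix_inv_apply (measurable_matrix_mul_apply hDt hD))) hDt
  have hM := measurable_matrix_mul_apply (measurable_matrix_mul_apply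
    (measurable_matrix_inv_apply (measurable_matrix_mul_apply
      (measurable_matrix_mul_apply hRt hP) hR)) hRt) hP
  refine (WithLp.measurable_toLp 2 _).comp (measurable_pi_lambda _ fun j => ?_)
  simp only [Matrix.mulVec, dotProduct]
  exact Finset.measurable_fun_sum _ fun i _ => (hM j i).mul (hy i)

lemma measurable_cellCount (hcell : ∀ k, MeasurableSet (cell k)) (hz : ∀ i, Measurable (z i))
    (k : Fin K) : Measurable fun ω => cellCount cell (fun i => z i ω) k :=
  Finset.measurable_fun_sum _ fun i _ => measurable_dummies_apply hcell hz i k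

lemma measurable_wHat_apply (hcell : ∀ k, MeasurableSet (cell k)) (hz : ∀ i, Measurable (z i))
    (hx : ∀ i, Measurable (x i)) (k : Fin K) (j : Idx dz dx) :
    Measurable fun ω => wHat cell (fun i => z i ω) (fun i => x i ω) k j := by
  refine measurable_stack_apply measurable_const ?_ ?_ j
  · exact (measurable_cellCount hcell hz k).inv.smul (Finset.measurable_fun_sum _ fun i _ =>
      (measurable_dummies_apply hcell hz i k).smul (hz i))
  · exact (measurable_cellCount hcell hz k).inv.smul (Finset.measurable_fun_sum _ fun i _ =>
      (measurable_dummies_apply hcell hz i k).smul (hx i))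

lemma measurable_gram_hat_apply (hcell : ∀ k, MeasurableSet (cell k))
    (hz : ∀ i, Measurable (z i)) (hx : ∀ i, Measurable (x i)) (a b : Idx dz dx) :
    Measurable fun ω => gram (pHat cell fun i => z i ω)
      (wHat cell (fun i => z i ω) fun i => x i ω) a b := by
  simp only [gram, Matrix.sum_apply, Matrix.smul_apply, Matrix.vecMulVec_apply, smul_eq_mul]
  exact Finset.measurable_fun_sum _ fun k _ => ((measurable_cellCount hcell hz k).div_const _).mul
    ((measurable_wHat_apply hcell hz hx k a).mul (measurable_wHat_apply hcell hz hx k b))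

lemma measurable_gram_inv_mul_apply (hcell : ∀ k, MeasurableSet (cell k))
    (hz : ∀ i, Measurable (z i)) (hx : ∀ i, Measurable (x i)) (a : Idx dz dx) (k : Fin K) :
    Measurable fun ω => ((gram (pHat cell fun i => z i ω)
      (wHat cell (fun i => z i ω) fun i => x i ω))⁻¹ *
      (Matrix.of (wHat cell (fun i => z i ω) fun i => x i ω)).transpose) a k :=
  measurable_matrix_mul_apply (measurable_matrix_inv_apply (measurable_gram_hat_apply hcell hz hx))
    (fun j k => measurable_wHat_apply hcell hz hx k j) a k

lemma measurable_resid (hcell : ∀ k, MeasurableSet (cell k)) (hy : ∀ i, Measurable (y i))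
    (hz : ∀ i, Measurable (z i)) (hx : ∀ i, Measurable (x i)) (i : Fin n) :
    Measurable fun ω => resid cell (fun i => y i ω) (fun i => z i ω) (fun i => x i ω) i := by
  have ht := measurable_tsls (cell := cell) hcell hy hz hx
  refine (hy i).sub (Finset.measurable_fun_sum _ fun j _ =>
    (measurable_stack_apply measurable_const (hz i) (hx i) j).mul ?_)
  fun_prop

lemma measurable_vHat_apply (hcell : ∀ k, MeasurableSet (cell k)) (hy : ∀ i, Measurable (y i))
    (hz : ∀ i, Measurable (z i)) (hx : ∀ i, Measurable (x i)) (a b : Idx dz dx) :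
    Measurable fun ω =>
      vHat cell (fun i => y i ω) (fun i => z i ω) (fun i => x i ω) a b := by
  have hG := measurable_matrix_inv_apply (measurable_gram_hat_apply (cell := cell) hcell hz hx)
  refine measurable_matrix_mul_apply (measurable_matrix_mul_apply hG fun c d => ?_) hG a b
  simp only [gram, Matrix.sum_apply, Matrix.smul_apply, Matrix.vecMulVec_apply, smul_eq_mul]
  refine Finset.measurable_fun_sum _ fun k _ => Measurable.mul ?_
    ((measurable_wHat_apply hcell hz hx k c).mul (measurable_wHat_apply hcell hz hx k d))
  refine ((measurable_cellCount hcell hz k).div_const _).mul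
    ((measurable_cellCount hcell hz k).inv.smul (Finset.measurable_fun_sum _ fun i _ =>
      (measurable_dummies_apply hcell hz i k).smul
        ((measurable_resid hcell hy hz hx i).pow_const 2)))

lemma measurable_pooledSigmaSqHat (hcell : ∀ k, MeasurableSet (cell k))
    (hy : ∀ i, Measurable (y i)) (hz : ∀ i, Measurable (z i)) (hx : ∀ i, Measurable (x i)) :
    Measurable fun ω =>
      pooledSigmaSqHat cell (fun i => y i ω) (fun i => z i ω) (fun i => x i ω) :=
  (Finset.measurable_fun_sum _ fun i _ =>
    (measurable_resid hcell hy hz hx i).pow_const 2).const_mul _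

end Measurability

/-! ### Population cell moments and the strong law -/

section Population

lemma cellInd_mul_eq_indicator {Ω : Type*} {dz K : ℕ} {cell : Fin K → Set (Vec dz)}
    {Z : Ω → Vec dz} (f : Ω → ℝ) (k : Fin K) :
    (fun ω => cellInd cell k (Z ω) * f ω) = (Z ⁻¹' cell k).indicator f := by
  funext ω
  by_cases h : Z ω ∈ cell k
  · rw [Set.indicator_of_mem (Set.mem_preimage.2 h)]
    simp [cellInd, h]
  · rw [Set.indicator_of_notMem (fun h' => h (Set.mem_preimage.1 h'))]
    simp [cellInd, h]

variable {Ω : Type*} [MeasurableSpace Ω] {P : Measure Ω}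
  {dz dx K : ℕ} {cell : Fin K → Set (Vec dz)} {Z : Ω → Vec dz} {X : Ω → Vec dx}

lemma integrable_cellInd_mul (hZ : Measurable Z) (hcell : ∀ k, MeasurableSet (cell k))
    {f : Ω → ℝ} (hf : Integrable f P) (k : Fin K) :
    Integrable (fun ω => cellInd cell k (Z ω) * f ω) P := by
  rw [cellInd_mul_eq_indicator]
  exact hf.indicator (hZ (hcell k))

lemma integral_cellInd_mul_eq_setIntegral (hZ : Measurable Z)
    (hcell : ∀ k, MeasurableSet (cell k)) (f : Ω → ℝ) (k : Fin K) :
    ∫ ω, cellInd cell k (Z ω) * f ω ∂P = ∫ ω in Z ⁻¹' cell k, f ω ∂P := by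
  rw [cellInd_mul_eq_indicator, integral_indicator (hZ (hcell k))]

lemma cellProb_pos [IsProbabilityMeasure P] (hpos : ∀ k, 0 < P (Z ⁻¹' cell k)) (k : Fin K) :
    0 < cellProb P cell Z k :=
  ENNReal.toReal_pos (hpos k).ne' (measure_ne_top _ _)

/-- The cell mean integrates against the restriction of P normalised by p_k; positivity of p_k lets
the normalisation be undone. -/
lemma integral_cellInd_mul [IsProbabilityMeasure P] (hZ : Measurable Z)
    (hcell : ∀ k, MeasurableSet (cell k)) (hpos : ∀ k, 0 < P (Z ⁻¹' cell k)) (f : Ω → ℝ)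
    (k : Fin K) :
    ∫ ω, cellInd cell k (Z ω) * f ω ∂P = cellProb P cell Z k * cellMean P cell Z f k := by
  rw [integral_cellInd_mul_eq_setIntegral hZ hcell, cellMean, ProbabilityTheory.cond,
    integral_smul_measure, smul_eq_mul, ENNReal.toReal_inv]
  exact (mul_inv_cancel_left₀ (cellProb_pos hpos k).ne' _).symm

lemma cellMean_apply {d : ℕ} {U : Ω → Vec d} (hU : Integrable U P)
    (hpos : ∀ k, 0 < P (Z ⁻¹' cell k)) (k : Fin K) (j : Fin d) :
    cellMean P cell Z U k j = cellMean P cell Z (fun ω => U ω j) k := by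
  have hi : Integrable U (ProbabilityTheory.cond P (Z ⁻¹' cell k)) :=
    (hU.mono_measure Measure.restrict_le_self).smul_measure (ENNReal.inv_ne_top.2 (hpos k).ne')
  exact ((EuclideanSpace.proj j : Vec d →L[ℝ] ℝ).integral_comp_comm hi).symm

lemma wBar_apply [IsProbabilityMeasure P] (hZi : Integrable Z P) (hXi : Integrable X P)
    (hpos : ∀ k, 0 < P (Z ⁻¹' cell k)) (k : Fin K) (j : Idx dz dx) :
    wBar P cell Z X k j = cellMean P cell Z (fun ω => stack 1 (Z ω) (X ω) j) k := by
  rcases j with _ | j | j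
  · have : IsProbabilityMeasure (ProbabilityTheory.cond P (Z ⁻¹' cell k)) :=
      cond_isProbabilityMeasure (hpos k).ne'
    simp [wBar, stack, cellMean]
  · exact cellMean_apply hZi hpos k j
  · exact cellMean_apply hXi hpos k j

lemma memLp_stack_apply [IsProbabilityMeasure P] {r : ENNReal} (hZ : MemLp Z r P)
    (hX : MemLp X r P) (j : Idx dz dx) :
    MemLp (fun ω => stack 1 (Z ω) (X ω) j) r P := by
  rcases j with _ | j | j
  · exact memLp_const 1
  · exact (EuclideanSpace.proj j : Vec dz →L[ℝ] ℝ).comp_memLp' hZ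
  · exact (EuclideanSpace.proj j : Vec dx →L[ℝ] ℝ).comp_memLp' hX

/-- Mean independence makes the errors average to zero within each cell. -/
lemma integral_cellInd_mul_eq_zero [IsProbabilityMeasure P] {e : Ω → ℝ} (hZ : Measurable Z)
    (hcell : ∀ k, MeasurableSet (cell k)) (he : Integrable e P)
    (hexog : P[e | MeasurableSpace.comap Z inferInstance] =ᵐ[P] 0) (k : Fin K) :
    ∫ ω, cellInd cell k (Z ω) * e ω ∂P = 0 := by
  -- The event {Z ∈ cell k} is σ(Z)-measurable, so the error may be replaced by its conditional
  -- expectation there.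
  rw [integral_cellInd_mul_eq_setIntegral hZ hcell,
    ← setIntegral_condExp hZ.comap_le he ⟨cell k, hcell k, rfl⟩]
  rw [setIntegral_congr_ae (g := fun _ => 0) (hZ (hcell k)) (hexog.mono fun ω h _ => h)]
  simp

lemma tendsto_average {𝓥 : Type*} [MeasurableSpace 𝓥] {V : ℕ → Ω → 𝓥}
    (hindep : iIndepFun V P) (hident : ∀ i, IdentDistrib (V i) (V 0) P P) {h : 𝓥 → ℝ}
    (hh : Measurable h) (hint : Integrable (fun ω => h (V 0 ω)) P) :
    ∀ᵐ ω ∂P, Tendsto (fun n : ℕ => (n : ℝ)⁻¹ * ∑ i : Fin n, h (V i ω)) atTop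
      (𝓝 (∫ ω, h (V 0 ω) ∂P)) := by
  have := strong_law_ae (fun i ω => h (V i ω)) hint
    (fun i j hij => (hindep.indepFun hij).comp hh hh) (fun i => (hident i).comp hh)
  filter_upwards [this] with ω hω
  refine hω.congr fun n => ?_
  rw [smul_eq_mul, Fin.sum_univ_eq_sum_range (fun i => h (V i ω))]

end Population

/-! ### Almost sure moment limits, the score, and Slutsky's theorem -/

section Asymptotics

variable {Ω : Type*} [MeasurableSpace Ω] {P : Measure Ω} [IsProbabilityMeasure P]

/-- The tails ⋂_{m ≥ n} A_m increase to a set of full measure, and A_n contains the n-th tail.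
Continuity from below along a monotone sequence needs no measurability of the A_n. -/
lemma tendsto_measure_of_ae_eventually {A : ℕ → Set Ω} (h : ∀ᵐ ω ∂P, ∀ᶠ n in atTop, ω ∈ A n) :
    Tendsto (fun n => P (A n)) atTop (𝓝 1) := by
  have hmono : Monotone fun n => ⋂ m ≥ n, A m := fun n n' hn =>
    Set.biInter_mono (fun m hm => le_trans hn hm) fun _ _ => subset_rfl
  have hU : P (⋃ n, ⋂ m ≥ n, A m) = 1 := by
    rw [← measure_univ (μ := P)]
    refine measure_congr (eventuallyEq_univ.2 ?_)
    filter_upwards [h] with ω hω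
    obtain ⟨n, hn⟩ := eventually_atTop.1 hω
    exact Set.mem_iUnion.2 ⟨n, Set.mem_iInter₂.2 hn⟩
  have hlim := tendsto_measure_iUnion_atTop (μ := P) hmono
  rw [hU] at hlim
  refine tendsto_of_tendsto_of_tendsto_of_le_of_le hlim tendsto_const_nhds
    (fun n => measure_mono (Set.iInter₂_subset n le_rfl)) fun n => prob_le_one

lemma inner_model {dz dx : ℕ} (α : ℝ) (β z : Vec dz) (γ x : Vec dx) :
    α + inner ℝ z β + inner ℝ x γ = ∑ j, stack 1 z x j * stack α β γ j := by
  simp only [stack, Fintype.sum_sum_type, Sum.elim_inl, Sum.elim_inr, Finset.univ_unique,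
    Finset.sum_singleton, one_mul, PiLp.inner_apply, RCLike.inner_apply, conj_trivial, ← add_assoc]
  simp only [mul_comm]

variable {dz dx K : ℕ} {V : ℕ → Ω → ℝ × Vec dz × Vec dx} {e : ℝ × Vec dz × Vec dx → ℝ}
  {cell : Fin K → Set (Vec dz)}

/-- The sample moments converge along almost every sample path. -/
lemma ae_momentLimits (hV : ∀ i, Measurable (V i)) (hindep : iIndepFun V P)
    (hident : ∀ i, IdentDistrib (V i) (V 0) P P) (he : Measurable e)
    (hexog : P[fun ω => e (V 0 ω) | MeasurableSpace.comap (fun ω => (V 0 ω).2.1) inferInstance]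
      =ᵐ[P] 0)
    (he4 : MemLp (fun ω => e (V 0 ω)) 4 P) (hX4 : MemLp (fun ω => (V 0 ω).2.2) 4 P)
    (hZ4 : MemLp (fun ω => (V 0 ω).2.1) 4 P) (hcell : ∀ k, MeasurableSet (cell k))
    (hpos : ∀ k, 0 < P ((fun ω => (V 0 ω).2.1) ⁻¹' cell k)) :
    ∀ᵐ ω ∂P, MomentLimits cell (fun i => (V i ω).2.1) (fun i => (V i ω).2.2)
      (fun i => e (V i ω)) (cellProb P cell fun ω => (V 0 ω).2.1)
      (wBar P cell (fun ω => (V 0 ω).2.1) fun ω => (V 0 ω).2.2)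
      (cellMean P cell (fun ω => (V 0 ω).2.1) fun ω => e (V 0 ω) ^ 2) := by
  have hZm : Measurable fun ω => (V 0 ω).2.1 := (hV 0).snd.fst
  have hZi := hZ4.integrable (by norm_num)
  have hXi := hX4.integrable (by norm_num)
  have hind : ∀ k, Measurable fun v : ℝ × Vec dz × Vec dx => cellInd cell k v.2.1 := fun k =>
    (measurable_cellInd hcell k).comp measurable_snd.fst
  have hst : ∀ j, Measurable fun v : ℝ × Vec dz × Vec dx => stack 1 v.2.1 v.2.2 j :=
    measurable_stack_apply measurable_const measurable_snd.fst measurable_snd.snd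
  have hw4 := fun j => memLp_stack_apply hZ4 hX4 j
  -- Square integrability suffices below: it makes every product of two factors among errors and
  -- regressors integrable.
  have hw2 := fun j => (hw4 j).mono_exponent (q := 4) (p := 2) (by norm_num)
  have he2 := he4.mono_exponent (p := 2) (by norm_num)
  have slln : ∀ (k : Fin K) {f : ℝ × Vec dz × Vec dx → ℝ}, Measurable f →
      Integrable (fun ω => f (V 0 ω)) P → ∀ᵐ ω ∂P, Tendsto (fun n : ℕ => (n : ℝ)⁻¹ *
        ∑ i : Fin n, cellInd cell k (V i ω).2.1 * f (V i ω)) atTop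
        (𝓝 (∫ ω, cellInd cell k (V 0 ω).2.1 * f (V 0 ω) ∂P)) := fun k f hf hfi =>
    tendsto_average hindep hident (h := fun v => cellInd cell k v.2.1 * f v)
      ((hind k).mul hf) (integrable_cellInd_mul hZm hcell hfi k)
  have h1 := ae_all_iff.2 fun k => slln k (f := fun _ => 1) measurable_const (integrable_const _)
  have h2 := ae_all_iff.2 fun k => ae_all_iff.2 fun j =>
    slln k (f := fun v => stack 1 v.2.1 v.2.2 j) (hst j) ((hw2 j).integrable (by norm_num))
  have h3 := ae_all_iff.2 fun k => slln k he (he2.integrable (by norm_num))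
  have h4 := ae_all_iff.2 fun k => slln k (f := fun v => e v ^ 2) (he.pow_const 2) he2.integrable_sq
  have h5 := ae_all_iff.2 fun k => ae_all_iff.2 fun j =>
    slln k (f := fun v => e v * stack 1 v.2.1 v.2.2 j) (he.mul (hst j))
      (he2.integrable_mul (hw2 j))
  have h6 := ae_all_iff.2 fun k => ae_all_iff.2 fun j => ae_all_iff.2 fun l =>
    slln k (f := fun v => stack 1 v.2.1 v.2.2 j * stack 1 v.2.1 v.2.2 l)
      ((hst j).mul (hst l)) ((hw2 j).integrable_mul (hw2 l))
  filter_upwards [h1, h2, h3, h4, h5, h6] with ω h1 h2 h3 h4 h5 h6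
  refine ⟨fun k => ?_, fun k j => ?_, fun k => ?_, fun k => ?_, fun k j => ⟨_, h5 k j⟩,
    fun k j l => ⟨_, h6 k j l⟩⟩
  · have h := h1 k
    rw [integral_cellInd_mul_eq_setIntegral hZm hcell] at h
    simpa [cellProb] using h
  · have h := h2 k j
    rwa [integral_cellInd_mul hZm hcell hpos, ← wBar_apply hZi hXi hpos] at h
  · have h := h3 k
    rwa [integral_cellInd_mul_eq_zero hZm hcell (he2.integrable (by norm_num)) hexog] at h
  · have h := h4 k
    rwa [integral_cellInd_mul hZm hcell hpos] at h

/-- Central limit theorem for the vector of scaled cell averages of the errors. -/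
lemma tendstoInDistribution_score (hV : ∀ i, Measurable (V i)) (hindep : iIndepFun V P)
    (hident : ∀ i, IdentDistrib (V i) (V 0) P P) (he : Measurable e)
    (hexog : P[fun ω => e (V 0 ω) | MeasurableSpace.comap (fun ω => (V 0 ω).2.1) inferInstance]
      =ᵐ[P] 0)
    (he2 : MemLp (fun ω => e (V 0 ω)) 2 P) (hcell : ∀ k, MeasurableSet (cell k))
    (hdisj : Pairwise (Function.onFun Disjoint cell))
    (hpos : ∀ k, 0 < P ((fun ω => (V 0 ω).2.1) ⁻¹' cell k))
    (hS : (Matrix.diagonal fun k => cellProb P cell (fun ω => (V 0 ω).2.1) k *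
      cellMean P cell (fun ω => (V 0 ω).2.1) (fun ω => e (V 0 ω) ^ 2) k).PosSemidef) :
    TendstoInDistribution (fun (n : ℕ) ω => (√(n : ℝ))⁻¹ • ∑ i ∈ Finset.range n,
      (WithLp.toLp 2 fun k => cellInd cell k (V i ω).2.1 * e (V i ω) :
        EuclideanSpace ℝ (Fin K))) atTop id (fun _ => P)
      (multivariateGaussian 0 (Matrix.diagonal fun k =>
        cellProb P cell (fun ω => (V 0 ω).2.1) k *
          cellMean P cell (fun ω => (V 0 ω).2.1) (fun ω => e (V 0 ω) ^ 2) k)) := by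
  have hZm : Measurable fun ω => (V 0 ω).2.1 := (hV 0).snd.fst
  have hg : Measurable fun v : ℝ × Vec dz × Vec dx =>
      (WithLp.toLp 2 fun k => cellInd cell k v.2.1 * e v : EuclideanSpace ℝ (Fin K)) :=
    (WithLp.measurable_toLp 2 _).comp (measurable_pi_lambda _ fun k =>
      ((measurable_cellInd hcell k).comp measurable_snd.fst).mul he)
  have hinner : ∀ (t : EuclideanSpace ℝ (Fin K)) ω,
      inner ℝ (WithLp.toLp 2 fun k => cellInd cell k (V 0 ω).2.1 * e (V 0 ω) :
        EuclideanSpace ℝ (Fin K)) t =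
      ∑ k, t k * (cellInd cell k (V 0 ω).2.1 * e (V 0 ω)) := fun t ω => by
    simp [PiLp.inner_apply]
  have hcc : ∀ k l v, cellInd cell k v * cellInd cell l v =
      if k = l then cellInd cell k v else 0 := fun k l v =>
    -- Disjointness is read off from the sample identity applied to the one-point sample v.
    dummies_mul_dummies (n := 1) (z := fun _ => v) hdisj 0 k l
  refine tendstoInDistribution_inv_sqrt_smul_sum (hindep.comp (fun _ => _) fun _ => hg)
    (fun i => (hident i).comp hg) ?_ hS (fun t => ?_) fun t => ?_
  · refine MemLp.of_eval_piLp fun k => ?_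
    change MemLp (fun ω => cellInd cell k (V 0 ω).2.1 * e (V 0 ω)) 2 P
    rw [cellInd_mul_eq_indicator (Z := fun ω => (V 0 ω).2.1) (fun ω => e (V 0 ω))]
    exact he2.indicator (hZm (hcell k))
  · simp only [Function.comp_apply, hinner]
    rw [integral_finsetSum _ fun k _ => (integrable_cellInd_mul hZm hcell
      (he2.integrable (by norm_num)) k).const_mul _]
    refine Finset.sum_eq_zero fun k _ => ?_
    rw [integral_const_mul, integral_cellInd_mul_eq_zero hZm hcell
      (he2.integrable (by norm_num)) hexog, mul_zero]
  -- Cross terms vanish pointwise because an observation lies in at most one cell; this is why the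
  -- limiting covariance is diagonal.
  · have hsq : ∀ ω, (∑ k, t k * (cellInd cell k (V 0 ω).2.1 * e (V 0 ω))) ^ 2 =
        ∑ k, t k ^ 2 * (cellInd cell k (V 0 ω).2.1 * e (V 0 ω) ^ 2) := fun ω => by
      rw [sq, Finset.sum_mul_sum]
      refine Finset.sum_congr rfl fun k _ => ?_
      have hterm : ∀ l, t k * (cellInd cell k (V 0 ω).2.1 * e (V 0 ω)) *
          (t l * (cellInd cell l (V 0 ω).2.1 * e (V 0 ω))) =
          if k = l then t k ^ 2 * (cellInd cell k (V 0 ω).2.1 * e (V 0 ω) ^ 2) else 0 := fun l => by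
        have h := hcc k l (V 0 ω).2.1
        split_ifs at h ⊢ with hkl
        · subst hkl
          linear_combination t k ^ 2 * e (V 0 ω) ^ 2 * h
        · linear_combination t k * t l * e (V 0 ω) ^ 2 * h
      simp [hterm]
    simp only [Function.comp_apply, hinner, hsq]
    rw [integral_finsetSum _ fun k _ => (integrable_cellInd_mul hZm hcell
      he2.integrable_sq k).const_mul _, dotProduct]
    refine Finset.sum_congr rfl fun k _ => ?_
    rw [integral_const_mul, integral_cellInd_mul hZm hcell hpos, Matrix.mulVec_diagonal]
    ring

/-- Slutsky's theorem for random matrices converging in probability, applied to asymptotically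
Gaussian vectors. -/
lemma tendstoInDistribution_mulVec {ι κ : Type*} [Fintype ι] [DecidableEq ι] [Fintype κ]
    [DecidableEq κ] {T : ℕ → Ω → EuclideanSpace ℝ ι} {S : Matrix ι ι ℝ} (hS : S.PosSemidef)
    (hT : TendstoInDistribution T atTop id (fun _ => P) (multivariateGaussian 0 S))
    {A : ℕ → Ω → Matrix κ ι ℝ} {A₀ : Matrix κ ι ℝ}
    (hAm : ∀ n a b, Measurable fun ω => A n ω a b)
    (hA : ∀ᵐ ω ∂P, Tendsto (fun n => A n ω) atTop (𝓝 A₀)) :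
    TendstoInDistribution (fun n ω => WithLp.toLp 2 ((A n ω).mulVec (T n ω).ofLp)) atTop
      (id : EuclideanSpace ℝ κ → EuclideanSpace ℝ κ) (fun _ => P)
      (multivariateGaussian 0 (A₀ * S * A₀.transpose)) := by
  have hg : Continuous fun q : EuclideanSpace ℝ ι × (κ → ι → ℝ) =>
      (WithLp.toLp 2 ((Matrix.of q.2).mulVec q.1.ofLp) : EuclideanSpace ℝ κ) := by
    refine (PiLp.continuous_toLp 2 _).comp (continuous_pi fun a => ?_)
    simp only [Matrix.mulVec, dotProduct, Matrix.of_apply]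
    fun_prop
  have hAm' : ∀ n, Measurable fun ω => (fun a b => A n ω a b : κ → ι → ℝ) := fun n =>
    measurable_pi_lambda _ fun a => measurable_pi_lambda _ fun b => hAm n a b
  have hAP : TendstoInMeasure P (fun n ω => (fun a b => A n ω a b : κ → ι → ℝ)) atTop
      fun _ => fun a b => A₀ a b :=
    tendstoInMeasure_of_tendsto_ae (fun n => (hAm' n).aestronglyMeasurable) hA
  have h := hT.continuous_comp_prodMk_of_tendstoInMeasure_const hg hAP
    fun n => (hAm' n).aemeasurable
  refine ⟨h.forall_aemeasurable, aemeasurable_id, ?_⟩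
  have hlaw : (multivariateGaussian 0 S).map (fun ω => (WithLp.toLp 2
      ((Matrix.of fun a b => A₀ a b).mulVec (id ω : EuclideanSpace ℝ ι).ofLp) :
        EuclideanSpace ℝ κ)) = (multivariateGaussian 0 (A₀ * S * A₀.transpose)).map id := by
    rw [Measure.map_id]
    exact map_multivariateGaussian hS A₀
  have ht := h.tendsto
  simp only [hlaw] at ht
  exact ht

end Asymptotics

/-! ### Asymptotic normality of the estimator -/

section Estimator

variable {Ω : Type*} [MeasurableSpace Ω] {P : Measure Ω} [IsProbabilityMeasure P]
  {dz dx K : ℕ} {cell : Fin K → Set (Vec dz)}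

/-- Asymptotic normality of two-stage least squares, from the limits of the sample moments and
asymptotic normality of the scaled cell averages of the errors. -/
lemma tendstoInDistribution_tsls {Y e : ℕ → Ω → ℝ} {Z : ℕ → Ω → Vec dz} {X : ℕ → Ω → Vec dx}
    {p s : Fin K → ℝ} {W : Fin K → Idx dz dx → ℝ} {θ : Idx dz dx → ℝ}
    (hYm : ∀ i, Measurable (Y i)) (hZm : ∀ i, Measurable (Z i)) (hXm : ∀ i, Measurable (X i))
    (hcell : ∀ k, MeasurableSet (cell k)) (hdisj : Pairwise (Function.onFun Disjoint cell))
    (hp : ∀ k, 0 < p k) (hs : ∀ k, 0 ≤ s k) (hu : IsUnit (gram p W))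
    (hmodel : ∀ i ω, Y i ω = ∑ j, stack 1 (Z i ω) (X i ω) j * θ j + e i ω)
    (hlim : ∀ᵐ ω ∂P, MomentLimits cell (fun i => Z i ω) (fun i => X i ω) (fun i => e i ω) p W s)
    (hclt : TendstoInDistribution (fun (n : ℕ) ω => (√(n : ℝ))⁻¹ • ∑ i ∈ Finset.range n,
      (WithLp.toLp 2 fun k => cellInd cell k (Z i ω) * e i ω : EuclideanSpace ℝ (Fin K)))
      atTop id (fun _ => P) (multivariateGaussian 0 (Matrix.diagonal fun k => p k * s k))) :
    TendstoInDistribution (fun (n : ℕ) ω => √(n : ℝ) • (tsls cell (fun i : Fin n => Y i ω)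
      (fun i : Fin n => Z i ω) (fun i : Fin n => X i ω) - WithLp.toLp 2 θ)) atTop
      (id : EuclideanSpace ℝ (Idx dz dx) → EuclideanSpace ℝ (Idx dz dx)) (fun _ => P)
      (multivariateGaussian 0 (sandwich p s W)) := by
  have hS : (Matrix.diagonal fun k => p k * s k).PosSemidef :=
    Matrix.PosSemidef.diagonal fun k => mul_nonneg (hp k).le (hs k)
  have hsl := tendstoInDistribution_mulVec hS hclt
    (A := fun n ω => (gram (pHat cell fun i : Fin n => Z i ω)
      (wHat cell (fun i : Fin n => Z i ω) fun i : Fin n => X i ω))⁻¹ *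
      (Matrix.of (wHat cell (fun i : Fin n => Z i ω) fun i : Fin n => X i ω)).transpose)
    (A₀ := (gram p W)⁻¹ * (Matrix.of W).transpose)
    (fun n a b => measurable_gram_inv_mul_apply hcell (fun i : Fin n => hZm i)
      (fun i : Fin n => hXm i) a b)
    (hlim.mono fun ω h => h.tendsto_gram_inv_mul hp hu)
  rw [← sandwich_eq_mul_diagonal_mul] at hsl
  have hmeas : ∀ n : ℕ, AEMeasurable (fun ω => √(n : ℝ) • (tsls cell (fun i : Fin n => Y i ω)
      (fun i : Fin n => Z i ω) (fun i : Fin n => X i ω) - WithLp.toLp 2 θ)) P := fun n =>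
    (((measurable_tsls hcell (fun i : Fin n => hYm i) (fun i : Fin n => hZm i)
      (fun i : Fin n => hXm i)).sub_const _).fun_const_smul _).aemeasurable
  -- The closed form of the sampling error is valid only from some path-dependent n on. There the
  -- difference from the Slutsky sequence is exactly zero, so it tends to zero almost surely, hence
  -- in probability.
  refine tendstoInDistribution_of_tendstoInMeasure_sub _ _ hsl ?_ hmeas
  refine tendstoInMeasure_of_tendsto_ae
    (fun n => ((hmeas n).sub (hsl.forall_aemeasurable n)).aestronglyMeasurable) ?_
  filter_upwards [hlim] with ω h
  refine tendsto_const_nhds.congr' ?_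
  filter_upwards [h.eventually_tsls_eq hp hu hdisj (fun i => hmodel i ω),
    eventually_ne_atTop 0] with n hn hn0
  have hn' : (0 : ℝ) < n := Nat.cast_pos.2 (Nat.pos_of_ne_zero hn0)
  have hsq : √(n : ℝ) * (n : ℝ)⁻¹ = (√(n : ℝ))⁻¹ := by
    have h0 := (Real.sqrt_pos.2 hn').ne'
    rw [← div_eq_mul_inv, div_eq_iff hn'.ne', ← Real.mul_self_sqrt hn'.le]
    rw [Real.sqrt_mul_self (Real.sqrt_nonneg _), inv_mul_cancel_left₀ h0]
  have hT : ((√(n : ℝ))⁻¹ • ∑ i ∈ Finset.range n, (WithLp.toLp 2 fun k =>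
      cellInd cell k (Z i ω) * e i ω : EuclideanSpace ℝ (Fin K))).ofLp =
      √(n : ℝ) • fun k => (n : ℝ)⁻¹ * ∑ i : Fin n, cellInd cell k (Z i ω) * e i ω := by
    funext k
    rw [← hsq]
    simp [WithLp.ofLp_sum, mul_assoc,
      Fin.sum_univ_eq_sum_range (fun i => cellInd cell k (Z i ω) * e i ω)]
  simp only [Pi.zero_apply, Pi.sub_apply]
  rw [hn, hT, Matrix.mulVec_smul, WithLp.toLp_add, add_sub_cancel_left, WithLp.toLp_smul, sub_self]

end Estimator

end DiscIV

end

/-! ### The main theorem -/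

theorem theorem4 {Ω : Type*} [MeasurableSpace Ω] (P : Measure Ω) [IsProbabilityMeasure P]
    (dz dx K : ℕ)
    -- observations `0, 1, 2, …` of `(Y, Z, X)`; a sample of size `n` consists of the first `n`
    (Y : ℕ → Ω → ℝ) (Z : ℕ → Ω → DiscIV.Vec dz) (X : ℕ → Ω → DiscIV.Vec dx) (ε : ℕ → Ω → ℝ)
    (hYm : ∀ i, Measurable (Y i)) (hZm : ∀ i, Measurable (Z i)) (hXm : ∀ i, Measurable (X i))
    -- i.i.d. sampling
    (hindep : iIndepFun (fun i ω => (Y i ω, Z i ω, X i ω)) P)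
    (hident : ∀ i, IdentDistrib (fun ω => (Y i ω, Z i ω, X i ω))
      (fun ω => (Y 0 ω, Z 0 ω, X 0 ω)) P P)
    -- the linear model
    (α₀ : ℝ) (β₀ : DiscIV.Vec dz) (γ₀ : DiscIV.Vec dx)
    (hmodel : ∀ i ω, Y i ω = α₀ + inner ℝ (Z i ω) β₀ + inner ℝ (X i ω) γ₀ + ε i ω)
    -- mean independence `E[ε | Z] = 0`
    (hexog : P[ε 0 | MeasurableSpace.comap (Z 0) inferInstance] =ᵐ[P] 0)
    -- finite fourth moments
    (hε4 : MemLp (ε 0) 4 P) (hX4 : MemLp (X 0) 4 P) (hZ4 : MemLp (Z 0) 4 P)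
    -- a finite partition of the support of `Z` into measurable cells
    (cell : Fin K → Set (DiscIV.Vec dz)) (hcell : ∀ k, MeasurableSet (cell k))
    (hdisj : Pairwise (Function.onFun Disjoint cell))
    (hcover : ⋃ k, cell k = (P.map (Z 0)).support)
    -- positive cell probabilities
    (hpos : ∀ k, 0 < P (Z 0 ⁻¹' cell k))
    -- no partitional multicollinearity
    (hrank : (DiscIV.wBarMatrix P cell (Z 0) (X 0)).rank = 1 + dz + dx) :
    let p := DiscIV.cellProb P cell (Z 0)
    let W := DiscIV.wBar P cell (Z 0) (X 0)
    let σsq := DiscIV.cellMean P cell (Z 0) (fun ω => ε 0 ω ^ 2)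
    let V := DiscIV.sandwich p σsq W
    let θ₀ : EuclideanSpace ℝ (DiscIV.Idx dz dx) := WithLp.toLp 2 (DiscIV.stack α₀ β₀ γ₀)
    let y := fun (n : ℕ) (ω : Ω) (i : Fin n) => Y i ω
    let z := fun (n : ℕ) (ω : Ω) (i : Fin n) => Z i ω
    let x := fun (n : ℕ) (ω : Ω) (i : Fin n) => X i ω
    -- the limiting variance and, with probability tending to one, the estimator are well defined
    IsUnit (DiscIV.gram p W) ∧ V.PosSemidef ∧
    Tendsto (fun n => P {ω | DiscIV.TslsWellDefined cell (z n ω) (x n ω)}) atTop (𝓝 1) ∧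
    -- asymptotic normality
    TendstoInDistribution
      (fun (n : ℕ) ω => √(n : ℝ) • (DiscIV.tsls cell (y n ω) (z n ω) (x n ω) - θ₀))
      atTop (id : EuclideanSpace ℝ (DiscIV.Idx dz dx) → EuclideanSpace ℝ (DiscIV.Idx dz dx))
      (fun _ => P) (multivariateGaussian 0 V) ∧
    -- consistency of the plug-in variance estimator
    (∀ a b, TendstoInMeasure P (fun n ω => DiscIV.vHat cell (y n ω) (z n ω) (x n ω) a b) atTop
      (fun _ => V a b)) ∧
    -- homoskedasticity across cells
    (∀ s : ℝ, (∀ k, σsq k = s) →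
      V = s • (DiscIV.gram p W)⁻¹ ∧
      TendstoInMeasure P (fun n ω => DiscIV.pooledSigmaSqHat cell (y n ω) (z n ω) (x n ω)) atTop
        (fun _ => s)) := by
  intro p W σsq V θ₀ y z x
  let U : ℕ → Ω → ℝ × DiscIV.Vec dz × DiscIV.Vec dx := fun i ω => (Y i ω, Z i ω, X i ω)
  -- The model equation expresses the error as a measurable function of the observed triple, so the
  -- i.i.d. property and measurability pass to the errors.
  let g : ℝ × DiscIV.Vec dz × DiscIV.Vec dx → ℝ := fun v =>
    v.1 - α₀ - inner ℝ v.2.1 β₀ - inner ℝ v.2.2 γ₀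
  have hgε : ∀ i, ε i = fun ω => g (U i ω) := fun i => by
    funext ω
    simp only [g, U, hmodel]
    ring
  have hU : ∀ i, Measurable (U i) := fun i => (hYm i).prodMk ((hZm i).prodMk (hXm i))
  have hg : Measurable g := by fun_prop
  rw [hgε 0] at hexog hε4
  have hp : ∀ k, 0 < p k := DiscIV.cellProb_pos hpos
  have hσ : ∀ k, 0 ≤ σsq k := fun k => integral_nonneg fun ω => sq_nonneg _
  have hu : IsUnit (DiscIV.gram p W) := DiscIV.isUnit_gram hp hrank
  have hmodel' : ∀ i ω, Y i ω =
      ∑ j, DiscIV.stack 1 (Z i ω) (X i ω) j * DiscIV.stack α₀ β₀ γ₀ j + ε i ω := fun i ω => by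
    rw [hmodel, DiscIV.inner_model]
  have hlim : ∀ᵐ ω ∂P, DiscIV.MomentLimits cell (fun i => Z i ω) (fun i => X i ω)
      (fun i => ε i ω) p W σsq := by
    have h := DiscIV.ae_momentLimits hU hindep hident hg hexog hε4 hX4 hZ4 hcell hpos
    simp only [σsq, hgε]
    exact h
  have hclt : TendstoInDistribution (fun (n : ℕ) ω => (√(n : ℝ))⁻¹ • ∑ i ∈ Finset.range n,
      (WithLp.toLp 2 fun k => DiscIV.cellInd cell k (Z i ω) * ε i ω : EuclideanSpace ℝ (Fin K)))
      atTop id (fun _ => P)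
      (multivariateGaussian 0 (Matrix.diagonal fun k => p k * σsq k)) := by
    have hS : (Matrix.diagonal fun k => p k * σsq k).PosSemidef :=
      Matrix.PosSemidef.diagonal fun k => mul_nonneg (hp k).le (hσ k)
    simp only [σsq, hgε] at hS ⊢
    exact DiscIV.tendstoInDistribution_score hU hindep hident hg hexog
      (hε4.mono_exponent (by norm_num)) hcell hdisj hpos hS
  -- The cells cover only the support of the law of Z, which has full measure; countably many
  -- observations then all fall in it almost surely.
  have hcov : ∀ᵐ ω ∂P, ∀ i, Z i ω ∈ ⋃ k, cell k := by
    rw [ae_all_iff, hcover]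
    intro i
    have hmem : ∀ᵐ v ∂P.map (Z i), v ∈ (P.map (Z 0)).support := by
      have hmap : P.map (Z i) = P.map (Z 0) :=
        ((hident i).comp (u := fun v : ℝ × DiscIV.Vec dz × DiscIV.Vec dx => v.2.1)
          measurable_snd.fst).map_eq
      rw [hmap]
      exact Measure.support_mem_ae
    exact ae_of_ae_map (hZm i).aemeasurable hmem
  refine ⟨hu, DiscIV.sandwich_posSemidef (fun k => (hp k).le) hσ W, ?_, ?_, fun a b => ?_,
    fun s hs => ⟨DiscIV.sandwich_eq_smul_inv hu hs, ?_⟩⟩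
  · exact DiscIV.tendsto_measure_of_ae_eventually
      (hlim.mono fun ω h => h.eventually_tslsWellDefined hp hu hdisj)
  · exact DiscIV.tendstoInDistribution_tsls hYm hZm hXm hcell hdisj hp hσ hu hmodel' hlim hclt
  · refine tendstoInMeasure_of_tendsto_ae (fun n => (DiscIV.measurable_vHat_apply hcell
      (fun i : Fin n => hYm i) (fun i : Fin n => hZm i) (fun i : Fin n => hXm i)
      a b).aestronglyMeasurable) ?_
    filter_upwards [hlim] with ω h
    exact tendsto_pi_nhds.1 (tendsto_pi_nhds.1
      (h.tendsto_vHat hp hu hdisj fun i => hmodel' i ω) a) b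
  · refine tendstoInMeasure_of_tendsto_ae (fun n => (DiscIV.measurable_pooledSigmaSqHat hcell
      (fun i : Fin n => hYm i) (fun i : Fin n => hZm i)
      (fun i : Fin n => hXm i)).aestronglyMeasurable) ?_
    filter_upwards [hlim, hcov] with ω h hc
    exact h.tendsto_pooledSigmaSqHat hp hu hdisj (fun i => hmodel' i ω) hc hs
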